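/- **Lemma (scaled, weighted Korn inequality).** For $0<L<1$ let $\Omega=(0,L)\times(0,\infty)$, with points $(x,y)$, and let $w(x)=1-x$. For $0<\epsilon\le 1$ and $\gamma\in\mathbb R$ let $C_{0,S}$ be the set of pairs $(\varphi,\phi)$ of functions smooth on $\overline\Omega$, compactly supported in $y\in(0,\infty)$, supported away from $x=0$, with $\partial_x\varphi+\partial_y\phi=0$. Let $\mathcal X_0$ be the closure of $C_{0,S}$ in the norm $\|u_y,\sqrt\epsilon v_y,\epsilon v_x\|_{L^2(\Omega)}$ (a space of pairs of $L^2(\Omega)$ functions, by Poincaré's inequality in $x$), and let $\mathcal X=\{[u,v]\in\mathcal X_0:\|u,v\|_{\mathcal X}<\infty\}$, where derivatives are weak, values at $x=L$ are traces, and $$\|u,v\|_{\mathcal X}=\|u_y\cdot y\|_{L^2}+\|\sqrt\epsilon u_x\cdot y\|_{L^2}+\|v_y,\sqrt\epsilon v_x\|_{L^2}+\|\{u_{yy},\sqrt\epsilon u_{xy},\epsilon u_{xx}\}\cdot y\|_{L^2}+\epsilon^{\gamma/2}\|u,\sqrt\epsilon v\|_{L^\infty}+\|u_y\cdot y,\sqrt\epsilon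 u_x\cdot y\|_{L^2(x=L)}+\|\sqrt\epsilon u_x\|_{L^2(x=L)}.$$ For every $L_0\in(0,1)$ there are constants $c,C>0$, depending only on $L_0$, such that for all $L\in(0,L_0]$, $\epsilon\in(0,1]$, $\gamma\in\mathbb R$ and all $[u,v]\in\mathcal X$ the following integrals converge and $$\int_\Omega\big[u_{yy}^2+4\epsilon u_{xy}^2+\epsilon^2u_{xx}^2-2\epsilon u_{yy}u_{xx}\big]y^2w\,dx\,dy\ \ge\ c\int_\Omega\big[u_{yy}^2+\epsilon u_{xy}^2+\epsilon^2u_{xx}^2\big]y^2w\,dx\,dy-C\Big(\epsilon\|u_y\cdot y,\sqrt\epsilon u_x\cdot y\|_{L^2(\Omega)}^2+\|u_y,u_x\|_{L^2(\Omega)}^2\Big),$$ where $\|f,g\|_{L^2}^2=\|f\|_{L^2}^2+\|g\|_{L^2}^2$. -/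

import Mathlib

open MeasureTheory Set Filter Topology
open scoped ENNReal ContDiff

noncomputable section

/-- The half-infinite strip `Ω = (0, L) × (0, ∞)`; a point is `z = (x, y)`. -/
def strip (L : ℝ) : Set (ℝ × ℝ) := Ioo 0 L ×ˢ Ioi 0

/-- Lebesgue measure on the strip. -/
def stripMeasure (L : ℝ) : Measure (ℝ × ℝ) := volume.restrict (strip L)

/-- The weight `w(x) = 1 - x`. -/
def kornWeight (x : ℝ) : ℝ := 1 - x

/-- `g` is the weak derivative of `f` in the direction `e` on the strip. -/
def HasWeakPartial (L : ℝ) (e : ℝ × ℝ) (f g : ℝ × ℝ → ℝ) : Prop :=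
  LocallyIntegrableOn f (strip L) ∧ LocallyIntegrableOn g (strip L) ∧
    ∀ η : ℝ × ℝ → ℝ, ContDiff ℝ ∞ η → HasCompactSupport η → tsupport η ⊆ strip L →
      ∫ z in strip L, f z * fderiv ℝ η z e = -∫ z in strip L, g z * η z

open Classical in
/-- The weak derivative of `f` in the direction `e` (unique up to null sets), when it exists. -/
def weakPartial (L : ℝ) (e : ℝ × ℝ) (f : ℝ × ℝ → ℝ) : ℝ × ℝ → ℝ :=
  if h : ∃ g, HasWeakPartial L e f g then h.choose else 0

theorem hasWeakPartial_weakPartial {L : ℝ} {e : ℝ × ℝ} {f : ℝ × ℝ → ℝ}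
    (h : ∃ g, HasWeakPartial L e f g) : HasWeakPartial L e f (weakPartial L e f) := by
  unfold weakPartial
  rw [dif_pos h]
  exact h.choose_spec

/-- Weak `∂/∂x`. -/
def wdx (L : ℝ) (f : ℝ × ℝ → ℝ) : ℝ × ℝ → ℝ := weakPartial L (1, 0) f

/-- Weak `∂/∂y`. -/
def wdy (L : ℝ) (f : ℝ × ℝ → ℝ) : ℝ × ℝ → ℝ := weakPartial L (0, 1) f

/-- Both first-order weak derivatives of `f` exist. -/
def WeaklyDifferentiable (L : ℝ) (f : ℝ × ℝ → ℝ) : Prop :=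
  (∃ g, HasWeakPartial L (1, 0) f g) ∧ (∃ g, HasWeakPartial L (0, 1) f g)

/-- `g` is the trace of `f` on the side `x = L`: Green's formula in `x` holds for all test
functions that may be nonzero on that side but vanish near `x = 0` and near `y = 0`. -/
def HasRightTrace (L : ℝ) (f : ℝ × ℝ → ℝ) (g : ℝ → ℝ) : Prop :=
  LocallyIntegrableOn g (Ioi 0) ∧
    ∀ η : ℝ × ℝ → ℝ, ContDiff ℝ ∞ η → HasCompactSupport η →
      tsupport η ⊆ Ioi 0 ×ˢ Ioi 0 →
      ∫ z in strip L, f z * fderiv ℝ η z (1, 0) =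
        (∫ y in Ioi 0, g y * η (L, y)) - ∫ z in strip L, wdx L f z * η z

open Classical in
/-- The trace on `x = L` (unique up to null sets), when it exists. -/
def rightTrace (L : ℝ) (f : ℝ × ℝ → ℝ) : ℝ → ℝ :=
  if h : ∃ g, HasRightTrace L f g then h.choose else 0

theorem hasRightTrace_rightTrace {L : ℝ} {f : ℝ × ℝ → ℝ}
    (h : ∃ g, HasRightTrace L f g) : HasRightTrace L f (rightTrace L f) := by
  unfold rightTrace
  rw [dif_pos h]
  exact h.choose_spec

/-- The `L^p` norm on the strip. -/
def stripNorm (p : ℝ≥0∞) (L : ℝ) (f : ℝ × ℝ → ℝ) : ℝ≥0∞ := eLpNorm f p (stripMeasure L)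

/-- The `L²` norm on the side `x = L`. -/
def sideNorm (g : ℝ → ℝ) : ℝ≥0∞ := eLpNorm g 2 (volume.restrict (Ioi (0 : ℝ)))

/-- The smooth divergence-free pairs on the strip (smooth up to the boundary) that are compactly
supported in `y ∈ (0, ∞)` and supported away from `x = 0`; no condition at `x = L`. -/
def IsTestPair (L : ℝ) (φ ψ : ℝ × ℝ → ℝ) : Prop :=
  ContDiff ℝ ∞ φ ∧ ContDiff ℝ ∞ ψ ∧
    (∃ δ a b : ℝ, 0 < δ ∧ 0 < a ∧
      ∀ z ∈ strip L, (z.1 < δ ∨ z.2 < a ∨ b < z.2) → φ z = 0 ∧ ψ z = 0) ∧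
    ∀ z ∈ strip L, fderiv ℝ φ z (1, 0) + fderiv ℝ ψ z (0, 1) = 0

/-- The space `𝒳₀`: closure of the test pairs in the norm `‖u_y, √ε v_y, ε v_x‖_{L²}`.
On test pairs this norm controls `‖φ, ψ‖_{L²}` (Poincaré inequality in `x`, with
`φ_x = -ψ_y`), so the abstract completion is identified with a space of pairs of functions by
also recording `L²` convergence of the functions themselves. -/
def spaceX0 (ε L : ℝ) : Set ((ℝ × ℝ → ℝ) × (ℝ × ℝ → ℝ)) :=
  {p | MemLp p.1 2 (stripMeasure L) ∧ MemLp p.2 2 (stripMeasure L) ∧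
    WeaklyDifferentiable L p.1 ∧ WeaklyDifferentiable L p.2 ∧
    ∃ φ ψ : ℕ → ℝ × ℝ → ℝ, (∀ n, IsTestPair L (φ n) (ψ n)) ∧
      Tendsto (fun n => stripNorm 2 L (fun z => p.1 z - φ n z)
        + stripNorm 2 L (fun z => p.2 z - ψ n z)) atTop (𝓝 0) ∧
      Tendsto (fun n =>
        stripNorm 2 L (fun z => wdy L p.1 z - fderiv ℝ (φ n) z (0, 1))
        + stripNorm 2 L (fun z => √ε * (wdy L p.2 z - fderiv ℝ (ψ n) z (0, 1)))
        + stripNorm 2 L (fun z => ε * (wdx L p.2 z - fderiv ℝ (ψ n) z (1, 0))))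
        atTop (𝓝 0)}

/-- The boundary norm
`‖u_y y, √ε u_x y‖_{L²(x = L)} + ‖√ε u_x‖_{L²(x = L)}`. -/
def normB (ε L : ℝ) (u : ℝ × ℝ → ℝ) : ℝ≥0∞ :=
  sideNorm (fun y => rightTrace L (wdy L u) y * y)
    + sideNorm (fun y => √ε * rightTrace L (wdx L u) y * y)
    + sideNorm (fun y => √ε * rightTrace L (wdx L u) y)

/-- The norm `‖u, v‖_𝒳`. -/
def normX (ε γ L : ℝ) (u v : ℝ × ℝ → ℝ) : ℝ≥0∞ :=
  stripNorm 2 L (fun z => wdy L u z * z.2)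
    + stripNorm 2 L (fun z => √ε * wdx L u z * z.2)
    + stripNorm 2 L (wdy L v)
    + stripNorm 2 L (fun z => √ε * wdx L v z)
    + stripNorm 2 L (fun z => wdy L (wdy L u) z * z.2)
    + stripNorm 2 L (fun z => √ε * wdy L (wdx L u) z * z.2)
    + stripNorm 2 L (fun z => ε * wdx L (wdx L u) z * z.2)
    + ENNReal.ofReal (ε ^ (γ / 2)) *
        (stripNorm ⊤ L u + stripNorm ⊤ L (fun z => √ε * v z))
    + normB ε L u

/-- The space `𝒳 = {[u, v] ∈ 𝒳₀ : ‖u, v‖_𝒳 < ∞}`; finiteness of the norm includes that the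
weak derivatives and the traces that occur in it exist. -/
def spaceX (ε γ L : ℝ) : Set ((ℝ × ℝ → ℝ) × (ℝ × ℝ → ℝ)) :=
  {p | p ∈ spaceX0 ε L ∧
    WeaklyDifferentiable L (wdx L p.1) ∧ WeaklyDifferentiable L (wdy L p.1) ∧
    (∃ g, HasRightTrace L (wdx L p.1) g) ∧ (∃ g, HasRightTrace L (wdy L p.1) g) ∧
    normX ε γ L p.1 p.2 < ⊤}

/-- The Korn energy density `[u_yy² + 4ε u_xy² + ε² u_xx² - 2ε u_yy u_xx] y² w(x)`. -/
def kornEnergy (ε L : ℝ) (u : ℝ × ℝ → ℝ) (z : ℝ × ℝ) : ℝ :=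
  (wdy L (wdy L u) z ^ 2 + 4 * ε * wdy L (wdx L u) z ^ 2 + ε ^ 2 * wdx L (wdx L u) z ^ 2
    - 2 * ε * wdy L (wdy L u) z * wdx L (wdx L u) z) * z.2 ^ 2 * kornWeight z.1

/-- The full second-order density `[u_yy² + ε u_xy² + ε² u_xx²] y² w(x)`. -/
def hessianEnergy (ε L : ℝ) (u : ℝ × ℝ → ℝ) (z : ℝ × ℝ) : ℝ :=
  (wdy L (wdy L u) z ^ 2 + ε * wdy L (wdx L u) z ^ 2 + ε ^ 2 * wdx L (wdx L u) z ^ 2)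
    * z.2 ^ 2 * kornWeight z.1

end

/-! Write p = y u_yy, q = y u_xy, r = y u_xx. The unweighted Korn density is (p - ε r)² + 4ε q², so
it is nonnegative, and the weight, which lies between 1 - L₀ and 1, costs only a constant. What is
missing is separate control of p and ε r: the square sees only their difference.

This is a Korn inequality for the pair a = y u_y, b = y u_x. Up to the lower order terms u_y and
u_x, one has a_y ~ p, a_x = q, b_x = r, b_y ~ q. In the whole plane, H¹ functions F, G satisfy ∫ F_y
G_x = ∫ F_x G_y (`integral_weakDeriv_mul_comm`), so the cross term hidden in (F_y - ε G_x)² is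
bounded by the mixed derivatives F_x and G_y; this is `plane_korn`.

To pass from the strip to the plane, a and b are extended by zero across x = 0 and y = 0, and across
x = L by a combination of two dilated reflections with different coefficients for a and b (Nitsche's
device). The coefficients are chosen so that both extensions match at x = L and F_y - ε G_x is
itself the extension of a_y - ε b_x. Hence `strip_korn`, with a constant independent of L and ε.

Extension by zero needs a and b to vanish, weakly, at y = 0 and x = 0. The factor y handles y = 0.
At x = 0, u_y vanishes because u does, and u_x = -v_y vanishes because v does; this is where the
divergence condition and the closure defining 𝒳₀ enter. All of it is expressed as Green formulas
against test functions unrestricted at x = 0 and y = 0 (`HasStripGreenX`, `HasStripGreenY`), proved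
with cutoffs and collected in `spaceX_regularity`. -/

/-! ### Korn's inequality in the whole plane -/

/-- `G` is the weak derivative of `F` in the direction `e` on the whole plane. -/
def HasPlaneWeakDeriv (e : ℝ × ℝ) (F G : ℝ × ℝ → ℝ) : Prop :=
  ∀ η : ℝ × ℝ → ℝ, ContDiff ℝ ∞ η → HasCompactSupport η →
    ∫ z, F z * fderiv ℝ η z e = -∫ z, G z * η z

theorem contDiff_fderiv_apply_const {η : ℝ × ℝ → ℝ} (hη : ContDiff ℝ ∞ η) (e : ℝ × ℝ) :
    ContDiff ℝ ∞ (fun z => fderiv ℝ η z e) :=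
  (hη.fderiv_right (m := ∞) (by simp)).clm_apply contDiff_const

theorem hasCompactSupport_fderiv_apply_const {η : ℝ × ℝ → ℝ} (hη : HasCompactSupport η)
    (e : ℝ × ℝ) : HasCompactSupport (fun z => fderiv ℝ η z e) :=
  hη.fderiv_apply (𝕜 := ℝ) e

theorem fderiv_fderiv_comm {η : ℝ × ℝ → ℝ} (hη : ContDiff ℝ ∞ η) (e e' z : ℝ × ℝ) :
    fderiv ℝ (fun w => fderiv ℝ η w e) z e' = fderiv ℝ (fun w => fderiv ℝ η w e') z e := by
  have hd : DifferentiableAt ℝ (fderiv ℝ η) z :=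
    ((hη.fderiv_right (m := ∞) (by simp)).differentiable (by simp)) z
  have hs : IsSymmSndFDerivAt ℝ η z :=
    hη.contDiffAt.isSymmSndFDerivAt (by
      rw [minSmoothness_of_isRCLikeNormedField]
      exact WithTop.coe_le_coe.2 (le_top : (2 : ℕ∞) ≤ ⊤))
  rw [fderiv_clm_apply hd (differentiableAt_const _),
    fderiv_clm_apply hd (differentiableAt_const _)]
  simpa using hs e' e

/-- Products of two square integrable functions against a translation kernel are integrable. -/
theorem integrable_mul_mul_kernel {F G k : ℝ × ℝ → ℝ} (hF : MemLp F 2 volume)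
    (hG : MemLp G 2 volume) (hk : Continuous k) (hk' : HasCompactSupport k) :
    Integrable (fun p : (ℝ × ℝ) × (ℝ × ℝ) => F p.2 * G p.1 * k (p.1 - p.2))
      (volume.prod volume) := by
  have hki : Integrable (fun z => |k z|) volume := (hk.integrable_of_hasCompactSupport hk').abs
  -- The integrand is dominated by (F² + G²)|k|, and each summand is a convolution integrand of two
  -- integrable functions.
  have h1 : Integrable (fun p : (ℝ × ℝ) × (ℝ × ℝ) => F p.2 ^ 2 * |k (p.1 - p.2)|)
      (volume.prod volume) := by
    simpa using hF.integrable_sq.convolution_integrand (ContinuousLinearMap.mul ℝ ℝ) hki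
  have h2 : Integrable (fun p : (ℝ × ℝ) × (ℝ × ℝ) => G p.1 ^ 2 * |k (p.1 - p.2)|)
      (volume.prod volume) := by
    have := (hG.integrable_sq.convolution_integrand (ContinuousLinearMap.mul ℝ ℝ)
      (hki.comp_neg)).swap
    simpa [Function.comp_def] using this
  refine (h1.add h2).mono ?_ (ae_of_all _ fun p => ?_)
  · exact (hF.1.comp_snd.mul hG.1.comp_fst).mul
      (hk.comp (continuous_fst.sub continuous_snd)).aestronglyMeasurable
  · simp only [Pi.add_apply, Real.norm_eq_abs, abs_mul]
    rw [← add_mul, abs_mul, abs_abs, abs_of_nonneg (by positivity : 0 ≤ F p.2 ^ 2 + G p.1 ^ 2)]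
    refine mul_le_mul_of_nonneg_right ?_ (abs_nonneg _)
    nlinarith [sq_abs (F p.2), sq_abs (G p.1), sq_nonneg (|F p.2| - |G p.1|),
      sq_nonneg (F p.2), sq_nonneg (G p.1)]

theorem fderiv_comp_sub_const {ρ : ℝ × ℝ → ℝ} (s z e : ℝ × ℝ) :
    fderiv ℝ (fun w => ρ (w - s)) z e = fderiv ℝ ρ (z - s) e := by
  rw [fderiv_comp_sub]

theorem fderiv_comp_const_sub {ρ : ℝ × ℝ → ℝ} (hρ : ContDiff ℝ ∞ ρ) (s z e : ℝ × ℝ) :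
    fderiv ℝ (fun w => ρ (z - w)) s e = - fderiv ℝ ρ (z - s) e := by
  have h := (hρ.differentiable (by simp) (z - s)).hasFDerivAt.comp s
    ((hasFDerivAt_id s).const_sub z)
  have h' : HasFDerivAt (fun w => ρ (z - w)) _ s := h
  rw [h'.fderiv]
  simp

theorem HasCompactSupport.comp_sub_const {ρ : ℝ × ℝ → ℝ} (h : HasCompactSupport ρ) (s : ℝ × ℝ) :
    HasCompactSupport (fun w => ρ (w - s)) :=
  h.comp_homeomorph (Homeomorph.subRight s)

theorem HasCompactSupport.comp_const_sub {ρ : ℝ × ℝ → ℝ} (h : HasCompactSupport ρ) (s : ℝ × ℝ) :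
    HasCompactSupport (fun w => ρ (s - w)) :=
  h.comp_homeomorph (Homeomorph.subLeft s)

/-- Both derivatives can be moved onto the kernel by Fubini: the one on G with the second variable
frozen, the one on F with the first frozen. The result depends on e₁, e₂ only through a second
derivative of ρ, which is symmetric. -/
theorem integral_weakDeriv_kernel {F F₁ G G₂ ρ : ℝ × ℝ → ℝ} {e₁ e₂ : ℝ × ℝ}
    (hF : MemLp F 2 volume) (hF₁ : MemLp F₁ 2 volume)
    (hG : MemLp G 2 volume) (hG₂ : MemLp G₂ 2 volume)
    (h₁ : HasPlaneWeakDeriv e₁ F F₁) (h₂ : HasPlaneWeakDeriv e₂ G G₂)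
    (hρ : ContDiff ℝ ∞ ρ) (hρ' : HasCompactSupport ρ) :
    ∫ p : (ℝ × ℝ) × (ℝ × ℝ), F₁ p.2 * G₂ p.1 * ρ (p.1 - p.2) =
      -∫ p : (ℝ × ℝ) × (ℝ × ℝ), F p.2 * G p.1 *
        fderiv ℝ (fun w => fderiv ℝ ρ w e₂) (p.1 - p.2) e₁ := by
  have hρ₂ := contDiff_fderiv_apply_const hρ e₂
  have hρ₂' := hasCompactSupport_fderiv_apply_const hρ' e₂
  have hρ₁ := contDiff_fderiv_apply_const hρ₂ e₁
  have hρ₁' := hasCompactSupport_fderiv_apply_const hρ₂' e₁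
  have i1 := integrable_mul_mul_kernel hF₁ hG₂ hρ.continuous hρ'
  have i2 := integrable_mul_mul_kernel hF₁ hG hρ₂.continuous hρ₂'
  have i3 := integrable_mul_mul_kernel hF hG hρ₁.continuous hρ₁'
  have e1 : ∫ p : (ℝ × ℝ) × (ℝ × ℝ), F₁ p.2 * G₂ p.1 * ρ (p.1 - p.2) =
      -∫ p : (ℝ × ℝ) × (ℝ × ℝ), F₁ p.2 * G p.1 * fderiv ℝ ρ (p.1 - p.2) e₂ := by
    rw [Measure.volume_eq_prod, integral_prod_symm _ i1, integral_prod_symm _ i2, ← integral_neg]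
    refine integral_congr_ae (ae_of_all _ fun s => ?_)
    have := h₂ (fun w => ρ (w - s)) (hρ.comp (contDiff_id.sub contDiff_const))
      (hρ'.comp_sub_const s)
    simp only [fderiv_comp_sub_const] at this
    simp only [mul_assoc, integral_const_mul]
    rw [this]; ring
  -- No sign appears: the minus of the weak derivative cancels the minus from differentiating w ↦
  -- ρ(z - w).
  have e2 : ∫ p : (ℝ × ℝ) × (ℝ × ℝ), F₁ p.2 * G p.1 * fderiv ℝ ρ (p.1 - p.2) e₂ =
      ∫ p : (ℝ × ℝ) × (ℝ × ℝ), F p.2 * G p.1 *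
        fderiv ℝ (fun w => fderiv ℝ ρ w e₂) (p.1 - p.2) e₁ := by
    rw [Measure.volume_eq_prod, integral_prod _ i2, integral_prod _ i3]
    refine integral_congr_ae (ae_of_all _ fun z => ?_)
    have := h₁ (fun w => fderiv ℝ ρ (z - w) e₂) (hρ₂.comp (contDiff_const.sub contDiff_id))
      (hρ₂'.comp_const_sub z)
    simp only [fderiv_comp_const_sub hρ₂, mul_neg, integral_neg, neg_inj] at this
    simp only [mul_right_comm _ (G z), integral_mul_const]
    rw [this]
  rw [e1, e2]

/-- The correlation is the L² inner product of f with a translate of g, and translation acts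
continuously on L². -/
theorem continuous_integral_mul_translate {f g : ℝ × ℝ → ℝ} (hf : MemLp f 2 volume)
    (hg : MemLp g 2 volume) : Continuous fun t => ∫ s, f s * g (s + t) := by
  have : Fact ((2 : ℝ≥0∞) ≠ ⊤) := ⟨ENNReal.ofNat_ne_top⟩
  have hc : Continuous fun t : ℝ × ℝ =>
      inner ℝ (hf.toLp f) ((DomAddAct.mk t) +ᵥ hg.toLp g : Lp ℝ 2 volume) :=
    continuous_const.inner ((DomAddAct.continuous_mk).vadd continuous_const)
  convert hc using 2 with t
  rw [L2.inner_def]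
  refine integral_congr_ae ?_
  have h2 := Lp.coeFn_compMeasurePreserving (hg.toLp g)
    (measurePreserving_vadd t (volume : Measure (ℝ × ℝ)))
  have h3 := (measurePreserving_vadd t (volume : Measure
    (ℝ × ℝ))).quasiMeasurePreserving.ae_eq_comp hg.coeFn_toLp
  filter_upwards [hf.coeFn_toLp, h2.trans h3] with s hs1 hs2
  have hs2' : ((DomAddAct.mk t +ᵥ hg.toLp g : Lp ℝ 2 volume)) s = g (t + s) := hs2
  rw [hs1, hs2']
  simp [mul_comm, add_comm]

/-- The shear (s, t) ↦ (s, s + t) preserves measure, so the kernel integral is the correlation of f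
and g tested against ρ. -/
theorem integral_kernel_eq {f g ρ : ℝ × ℝ → ℝ} (hf : MemLp f 2 volume)
    (hg : MemLp g 2 volume) (hρ : Continuous ρ) (hρ' : HasCompactSupport ρ) :
    ∫ p : (ℝ × ℝ) × (ℝ × ℝ), f p.2 * g p.1 * ρ (p.1 - p.2) =
      ∫ t, ρ t * ∫ s, f s * g (s + t) := by
  have i1 := integrable_mul_mul_kernel hf hg hρ hρ'
  have i1' := i1.swap
  have mp := measurePreserving_prod_add (volume : Measure (ℝ × ℝ)) (volume : Measure (ℝ × ℝ))
  have i2 := mp.integrable_comp_of_integrable i1'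
  have : ∫ p : (ℝ × ℝ) × (ℝ × ℝ), f p.2 * g p.1 * ρ (p.1 - p.2) =
      ∫ p : (ℝ × ℝ) × (ℝ × ℝ), f p.1 * g (p.1 + p.2) * ρ p.2 := by
    rw [Measure.volume_eq_prod, ← integral_prod_swap,
      ← mp.integral_comp (MeasurableEquiv.shearAddRight (ℝ × ℝ)).measurableEmbedding]
    simp
  rw [this, Measure.volume_eq_prod, integral_prod_symm]
  · refine integral_congr_ae (ae_of_all _ fun t => ?_)
    simp only [integral_mul_const]
    rw [mul_comm]
  · simpa [Function.comp_def] using i2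

/-- For `H¹` functions on the plane, `∫ F_y G_x = ∫ F_x G_y`. -/
theorem integral_weakDeriv_mul_comm {F F₁ F₂ G G₁ G₂ : ℝ × ℝ → ℝ} {e₁ e₂ : ℝ × ℝ}
    (hF : MemLp F 2 volume) (hF₁ : MemLp F₁ 2 volume) (hF₂ : MemLp F₂ 2 volume)
    (hG : MemLp G 2 volume) (hG₁ : MemLp G₁ 2 volume) (hG₂ : MemLp G₂ 2 volume)
    (dF₁ : HasPlaneWeakDeriv e₁ F F₁) (dF₂ : HasPlaneWeakDeriv e₂ F F₂)
    (dG₁ : HasPlaneWeakDeriv e₁ G G₁) (dG₂ : HasPlaneWeakDeriv e₂ G G₂) :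
    ∫ z, F₂ z * G₁ z = ∫ z, F₁ z * G₂ z := by
  have c1 := continuous_integral_mul_translate hF₂ hG₁
  have c2 := continuous_integral_mul_translate hF₁ hG₂
  -- The identity is proved for all correlations at shift t, tested against smooth ρ. Continuity in
  -- t then upgrades almost everywhere equality to equality at t = 0.
  have hae : (fun t => ∫ s, F₂ s * G₁ (s + t)) =ᵐ[volume] fun t => ∫ s, F₁ s * G₂ (s + t) := by
    refine ae_eq_of_integral_contDiff_smul_eq c1.locallyIntegrable c2.locallyIntegrable ?_
    intro ρ hρ hρ'
    simp only [smul_eq_mul]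
    rw [← integral_kernel_eq hF₂ hG₁ hρ.continuous hρ',
      ← integral_kernel_eq hF₁ hG₂ hρ.continuous hρ',
      integral_weakDeriv_kernel hF hF₂ hG hG₁ dF₂ dG₁ hρ hρ',
      integral_weakDeriv_kernel hF hF₁ hG hG₂ dF₁ dG₂ hρ hρ']
    simp only [fderiv_fderiv_comm hρ e₁ e₂]
  have := congrFun (c1.ae_eq_iff_eq volume c2 |>.1 hae) 0
  simpa using this

/-- Korn's inequality in the whole plane, in the form adapted to a gradient field. -/
theorem plane_korn {F Fx Fy G Gx Gy : ℝ × ℝ → ℝ} {ε : ℝ} (hε : 0 ≤ ε)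
    (hF : MemLp F 2 volume) (hFx : MemLp Fx 2 volume) (hFy : MemLp Fy 2 volume)
    (hG : MemLp G 2 volume) (hGx : MemLp Gx 2 volume) (hGy : MemLp Gy 2 volume)
    (dFx : HasPlaneWeakDeriv (1, 0) F Fx) (dFy : HasPlaneWeakDeriv (0, 1) F Fy)
    (dGx : HasPlaneWeakDeriv (1, 0) G Gx) (dGy : HasPlaneWeakDeriv (0, 1) G Gy) :
    (∫ z, Fy z ^ 2) + ε ^ 2 * (∫ z, Gx z ^ 2) ≤
      (∫ z, (Fy z - ε * Gx z) ^ 2) + ε * ((∫ z, Fx z ^ 2) + ∫ z, Gy z ^ 2) := by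
  -- This turns the cross term -2ε ∫ F_y G_x into -2ε ∫ F_x G_y, which only involves the mixed
  -- derivatives.
  have key := integral_weakDeriv_mul_comm hF hFx hFy hG hGx hGy dFx dFy dGx dGy
  have i1 := hFy.integrable_sq
  have i2 := hGx.integrable_sq
  have i3 : Integrable (fun z => Fy z * Gx z) volume := hFy.integrable_mul hGx
  have i4 : Integrable (fun z => Fx z * Gy z) volume := hFx.integrable_mul hGy
  have e1 : ∫ z, (Fy z - ε * Gx z) ^ 2 =
      (∫ z, Fy z ^ 2) + ε ^ 2 * (∫ z, Gx z ^ 2) - 2 * ε * ∫ z, Fy z * Gx z := by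
    have i12 : Integrable (fun z => Fy z ^ 2 + ε ^ 2 * Gx z ^ 2) volume := i1.add (i2.const_mul _)
    rw [← integral_const_mul, ← integral_const_mul, ← integral_add i1 (i2.const_mul _),
      ← integral_sub i12 (i3.const_mul _)]
    refine integral_congr_ae (ae_of_all _ fun z => ?_)
    simp only
    ring
  have e2 : 2 * ∫ z, Fx z * Gy z ≤ (∫ z, Fx z ^ 2) + ∫ z, Gy z ^ 2 := by
    rw [← integral_const_mul, ← integral_add hFx.integrable_sq hGy.integrable_sq]
    refine integral_mono (i4.const_mul _) (hFx.integrable_sq.add hGy.integrable_sq) fun z => ?_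
    simp only
    nlinarith [sq_nonneg (Fx z - Gy z)]
  rw [e1, key]
  nlinarith

/-! ### Reflections across x = L -/

/-- Reflection across the line `x = L`, combined with a dilation by `l` in `x`. -/
def reflectAcross (L l : ℝ) (z : ℝ × ℝ) : ℝ × ℝ := (L - l * (z.1 - L), z.2)

theorem reflectAcross_inv {L l : ℝ} (hl : l ≠ 0) (z : ℝ × ℝ) :
    reflectAcross L l⁻¹ (reflectAcross L l z) = z := by
  ext
  · simp only [reflectAcross]; field_simp; ring
  · rfl

theorem contDiff_reflectAcross (L l : ℝ) : ContDiff ℝ ∞ (reflectAcross L l) := by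
  unfold reflectAcross; fun_prop

/-- `reflectAcross` as a homeomorphism. -/
noncomputable def reflectAcrossHomeomorph (L l : ℝ) (hl : l ≠ 0) : (ℝ × ℝ) ≃ₜ (ℝ × ℝ) where
  toFun := reflectAcross L l
  invFun := reflectAcross L l⁻¹
  left_inv := reflectAcross_inv hl
  right_inv z := by simpa using reflectAcross_inv (L := L) (inv_ne_zero hl) z
  continuous_toFun := (contDiff_reflectAcross L l).continuous
  continuous_invFun := (contDiff_reflectAcross L l⁻¹).continuous

theorem map_reflectAcross_volume (L : ℝ) {l : ℝ} (hl : 0 < l) :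
    Measure.map (reflectAcross L l) volume = ENNReal.ofReal l⁻¹ • (volume : Measure (ℝ × ℝ)) := by
  have h1 : Measure.map (fun x : ℝ => L - l * (x - L)) volume =
      ENNReal.ofReal l⁻¹ • (volume : Measure ℝ) := by
    have : (fun x : ℝ => L - l * (x - L)) = (fun x => x + (L + l * L)) ∘ fun x => (-l) * x := by
      funext x; simp only [Function.comp]; ring
    rw [this, ← Measure.map_map (by fun_prop) (by fun_prop),
      Real.map_volume_mul_left (by linarith : -l ≠ 0), Measure.map_smul,
      map_add_right_eq_self, inv_neg, abs_neg, abs_of_pos (inv_pos.2 hl)]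
  have h2 : reflectAcross L l = Prod.map (fun x : ℝ => L - l * (x - L)) id := rfl
  rw [h2, Measure.volume_eq_prod, ← Measure.map_prod_map _ _ (by fun_prop) measurable_id,
    Measure.map_id, h1, Measure.prod_smul_left]

theorem integral_comp_reflectAcross (L : ℝ) {l : ℝ} (hl : 0 < l) (H : ℝ × ℝ → ℝ) :
    ∫ z, H (reflectAcross L l z) = l⁻¹ * ∫ z, H z := by
  have h := (reflectAcrossHomeomorph L l hl.ne').measurableEmbedding.integral_map
    (μ := volume) H
  change ∫ z, H z ∂(Measure.map (reflectAcross L l) volume) = ∫ z, H (reflectAcross L l z) at h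
  rw [← h, map_reflectAcross_volume L hl, integral_smul_measure,
    ENNReal.toReal_ofReal (inv_pos.2 hl).le, smul_eq_mul]

theorem MeasureTheory.MemLp.comp_reflectAcross {H : ℝ × ℝ → ℝ} (hH : MemLp H 2 volume) (L : ℝ)
    {l : ℝ} (hl : 0 < l) : MemLp (fun z => H (reflectAcross L l z)) 2 volume := by
  refine MemLp.comp_of_map (g := H) (f := reflectAcross L l) ?_
    (contDiff_reflectAcross L l).continuous.aemeasurable
  rw [map_reflectAcross_volume L hl]
  exact hH.smul_measure ENNReal.ofReal_ne_top

theorem fderiv_comp_reflectAcross {η : ℝ × ℝ → ℝ} (hη : ContDiff ℝ ∞ η) (L l : ℝ)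
    (z e : ℝ × ℝ) : fderiv ℝ (fun w => η (reflectAcross L l w)) z e =
      fderiv ℝ η (reflectAcross L l z) (-l * e.1, e.2) := by
  have h1 : HasFDerivAt (reflectAcross L l)
      ((-(l • ContinuousLinearMap.fst ℝ ℝ ℝ)).prod (ContinuousLinearMap.snd ℝ ℝ ℝ)) z :=
    ((((hasFDerivAt_fst).sub_const L).const_mul l).const_sub L).prodMk hasFDerivAt_snd
  have h : HasFDerivAt (fun w => η (reflectAcross L l w)) _ z :=
    (hη.differentiable (by simp) _).hasFDerivAt.comp z h1
  rw [h.fderiv]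
  simp

theorem HasCompactSupport.comp_reflectAcross {η : ℝ × ℝ → ℝ} (h : HasCompactSupport η)
    (L : ℝ) {l : ℝ} (hl : l ≠ 0) : HasCompactSupport (fun w => η (reflectAcross L l w)) :=
  h.comp_homeomorph (reflectAcrossHomeomorph L l hl)

/-- Combination of a function with its reflections across `x = L` with ratios `1` and `2`. -/
def reflectSum (L c₁ c₂ : ℝ) (H : ℝ × ℝ → ℝ) (z : ℝ × ℝ) : ℝ :=
  H z + c₁ * H (reflectAcross L 1 z) + c₂ * H (reflectAcross L 2 z)

theorem MeasureTheory.MemLp.reflectSum {H : ℝ × ℝ → ℝ} (hH : MemLp H 2 volume) (L c₁ c₂ : ℝ) :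
    MemLp (reflectSum L c₁ c₂ H) 2 volume :=
  (hH.add ((hH.comp_reflectAcross L one_pos).const_mul c₁)).add
    ((hH.comp_reflectAcross L two_pos).const_mul c₂)

theorem integral_comp_reflectAcross_mul (L : ℝ) {l : ℝ} (hl : 0 < l) (H K : ℝ × ℝ → ℝ) :
    ∫ z, H (reflectAcross L l z) * K z = l⁻¹ * ∫ z, H z * K (reflectAcross L l⁻¹ z) := by
  rw [← integral_comp_reflectAcross L hl]
  simp only [reflectAcross_inv hl.ne']

/-- The adjoint of the extension: the reflection of ratio 2 is moved to the other factor, becoming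
ratio 1/2 with Jacobian 1/2. -/
theorem integral_reflectSum_mul {H K : ℝ × ℝ → ℝ} (hH : MemLp H 2 volume)
    (hK : MemLp K 2 volume) (L c₁ c₂ : ℝ) :
    ∫ z, reflectSum L c₁ c₂ H z * K z =
      ∫ z, H z * (K z + c₁ * K (reflectAcross L 1 z) + c₂ / 2 * K (reflectAcross L 2⁻¹ z)) := by
  have i0 : Integrable (fun z => H z * K z) volume := hH.integrable_mul hK
  have i1 : Integrable (fun z => H (reflectAcross L 1 z) * K z) volume :=
    (hH.comp_reflectAcross L one_pos).integrable_mul hK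
  have i2 : Integrable (fun z => H (reflectAcross L 2 z) * K z) volume :=
    (hH.comp_reflectAcross L two_pos).integrable_mul hK
  have j1 : Integrable (fun z => H z * K (reflectAcross L 1 z)) volume :=
    hH.integrable_mul (hK.comp_reflectAcross L one_pos)
  have j2 : Integrable (fun z => H z * K (reflectAcross L 2⁻¹ z)) volume :=
    hH.integrable_mul (hK.comp_reflectAcross L (by norm_num))
  have e1 := integral_comp_reflectAcross_mul L one_pos H K
  have e2 := integral_comp_reflectAcross_mul L two_pos H K
  rw [inv_one, one_mul] at e1
  have l1 : ∫ z, reflectSum L c₁ c₂ H z * K z = (∫ z, H z * K z) +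
      c₁ * (∫ z, H (reflectAcross L 1 z) * K z) + c₂ * ∫ z, H (reflectAcross L 2 z) * K z := by
    have i01 : Integrable (fun z => H z * K z + c₁ * (H (reflectAcross L 1 z) * K z)) volume :=
      i0.add (i1.const_mul _)
    rw [← integral_const_mul, ← integral_const_mul, ← integral_add i0 (i1.const_mul _),
      ← integral_add i01 (i2.const_mul _)]
    refine integral_congr_ae (ae_of_all _ fun z => ?_)
    simp only [reflectSum]
    ring
  have l2 : ∫ z, H z * (K z + c₁ * K (reflectAcross L 1 z) +
      c₂ / 2 * K (reflectAcross L 2⁻¹ z)) = (∫ z, H z * K z) +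
      c₁ * (∫ z, H z * K (reflectAcross L 1 z)) +
      c₂ / 2 * ∫ z, H z * K (reflectAcross L 2⁻¹ z) := by
    have j01 : Integrable (fun z => H z * K z + c₁ * (H z * K (reflectAcross L 1 z))) volume :=
      i0.add (j1.const_mul _)
    rw [← integral_const_mul, ← integral_const_mul, ← integral_add i0 (j1.const_mul _),
      ← integral_add j01 (j2.const_mul _)]
    refine integral_congr_ae (ae_of_all _ fun z => ?_)
    simp only
    ring
  rw [l1, l2, e1, e2]
  ring

theorem integral_reflectSum_sq_le {H : ℝ × ℝ → ℝ} (hH : MemLp H 2 volume) (L c₁ c₂ : ℝ) :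
    ∫ z, reflectSum L c₁ c₂ H z ^ 2 ≤ 3 * (1 + c₁ ^ 2 + c₂ ^ 2 / 2) * ∫ z, H z ^ 2 := by
  have i0 := hH.integrable_sq
  have i1 := (hH.comp_reflectAcross L one_pos).integrable_sq
  have i2 := (hH.comp_reflectAcross L two_pos).integrable_sq
  have e1 := integral_comp_reflectAcross L one_pos (fun z => H z ^ 2)
  have e2 := integral_comp_reflectAcross L two_pos (fun z => H z ^ 2)
  have i01 : Integrable (fun z => 3 * H z ^ 2 + 3 * c₁ ^ 2 * H (reflectAcross L 1 z) ^ 2) volume :=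
    (i0.const_mul _).add (i1.const_mul _)
  calc ∫ z, reflectSum L c₁ c₂ H z ^ 2
      ≤ ∫ z, (3 * H z ^ 2 + 3 * c₁ ^ 2 * H (reflectAcross L 1 z) ^ 2 +
          3 * c₂ ^ 2 * H (reflectAcross L 2 z) ^ 2) := by
        refine integral_mono (hH.reflectSum L c₁ c₂).integrable_sq (i01.add (i2.const_mul _))
          fun z => ?_
        simp only [reflectSum]
        nlinarith [sq_nonneg (H z - c₁ * H (reflectAcross L 1 z)),
          sq_nonneg (H z - c₂ * H (reflectAcross L 2 z)),
          sq_nonneg (c₁ * H (reflectAcross L 1 z) - c₂ * H (reflectAcross L 2 z))]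
    _ = 3 * (1 + c₁ ^ 2 + c₂ ^ 2 / 2) * ∫ z, H z ^ 2 := by
        rw [integral_add i01 (i2.const_mul _), integral_add (i0.const_mul _) (i1.const_mul _),
          integral_const_mul, integral_const_mul, integral_const_mul, e1, e2]
        ring

theorem measurableSet_strip (L : ℝ) : MeasurableSet (strip L) :=
  measurableSet_Ioo.prod measurableSet_Ioi

theorem integral_indicator_strip_mul (L : ℝ) (a K : ℝ × ℝ → ℝ) :
    ∫ z, (strip L).indicator a z * K z = ∫ z in strip L, a z * K z := by
  rw [← integral_indicator (measurableSet_strip L)]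
  refine integral_congr_ae (ae_of_all _ fun z => ?_)
  simp only [Set.indicator_mul_left]

theorem memLp_indicator_strip {L : ℝ} {a : ℝ × ℝ → ℝ} (ha : MemLp a 2 (stripMeasure L)) :
    MemLp ((strip L).indicator a) 2 volume :=
  (memLp_indicator_iff_restrict (measurableSet_strip L)).2 ha

theorem integral_indicator_strip_sq (L : ℝ) (a : ℝ × ℝ → ℝ) :
    ∫ z, (strip L).indicator a z ^ 2 = ∫ z in strip L, a z ^ 2 := by
  rw [← integral_indicator (measurableSet_strip L)]
  refine integral_congr_ae (ae_of_all _ fun z => ?_)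
  by_cases h : z ∈ strip L <;> simp [h]

/-! ### Extension to the plane and Korn's inequality on the strip -/

/-- Green's formula on the strip in the direction `x`, with no condition on the test function at
`x = 0` and `y = 0`. -/
def HasStripGreenX (L : ℝ) (a ax : ℝ × ℝ → ℝ) : Prop :=
  ∀ ζ : ℝ × ℝ → ℝ, ContDiff ℝ ∞ ζ → HasCompactSupport ζ → (∀ y, ζ (L, y) = 0) →
    ∫ z in strip L, a z * fderiv ℝ ζ z (1, 0) = -∫ z in strip L, ax z * ζ z

/-- Green's formula on the strip in the direction `y`, with no condition on the test function at
the boundary. -/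
def HasStripGreenY (L : ℝ) (a ay : ℝ × ℝ → ℝ) : Prop :=
  ∀ ζ : ℝ × ℝ → ℝ, ContDiff ℝ ∞ ζ → HasCompactSupport ζ →
    ∫ z in strip L, a z * fderiv ℝ ζ z (0, 1) = -∫ z in strip L, ay z * ζ z

theorem ContDiff.comp_reflectAcross {η : ℝ × ℝ → ℝ} (hη : ContDiff ℝ ∞ η) (L l : ℝ) :
    ContDiff ℝ ∞ (fun w => η (reflectAcross L l w)) :=
  hη.comp (contDiff_reflectAcross L l)

theorem fderiv_reflect_combination {η : ℝ × ℝ → ℝ} (hη : ContDiff ℝ ∞ η) (L c d : ℝ)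
    (z e : ℝ × ℝ) :
    fderiv ℝ (fun w => η w + c * η (reflectAcross L 1 w) + d * η (reflectAcross L 2⁻¹ w)) z e =
      fderiv ℝ η z e + c * fderiv ℝ η (reflectAcross L 1 z) (-1 * e.1, e.2) +
        d * fderiv ℝ η (reflectAcross L 2⁻¹ z) (-2⁻¹ * e.1, e.2) := by
  have d0 := hη.differentiable (by simp) z
  have d1 := (hη.comp_reflectAcross L 1).differentiable (by simp) z
  have d2 := (hη.comp_reflectAcross L 2⁻¹).differentiable (by simp) z
  have h : HasFDerivAt
      (fun w => η w + c * η (reflectAcross L 1 w) + d * η (reflectAcross L 2⁻¹ w)) _ z :=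
    (d0.hasFDerivAt.add (d1.hasFDerivAt.const_mul c)).add (d2.hasFDerivAt.const_mul d)
  rw [h.fderiv]
  simp only [_root_.add_apply, _root_.smul_apply, smul_eq_mul,
    fderiv_comp_reflectAcross hη]

theorem memLp_of_contDiff {η : ℝ × ℝ → ℝ} (hη : ContDiff ℝ ∞ η) (h : HasCompactSupport η) :
    MemLp η 2 volume :=
  hη.continuous.memLp_of_hasCompactSupport h

theorem hasCompactSupport_reflect_combination {η : ℝ × ℝ → ℝ} (h : HasCompactSupport η)
    (L c d : ℝ) : HasCompactSupport
      (fun w => η w + c * η (reflectAcross L 1 w) + d * η (reflectAcross L 2⁻¹ w)) :=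
  (h.add ((h.comp_reflectAcross L one_ne_zero).mul_left (f := fun _ => c))).add
    ((h.comp_reflectAcross L (by norm_num)).mul_left (f := fun _ => d))

theorem contDiff_reflect_combination {η : ℝ × ℝ → ℝ} (h : ContDiff ℝ ∞ η)
    (L c d : ℝ) : ContDiff ℝ ∞
      (fun w => η w + c * η (reflectAcross L 1 w) + d * η (reflectAcross L 2⁻¹ w)) :=
  (h.add (contDiff_const.mul (h.comp_reflectAcross L 1))).add
    (contDiff_const.mul (h.comp_reflectAcross L 2⁻¹))

/-- The chain rule multiplies the coefficient of the ratio l reflection by -l. The condition c₁ + c₂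
= 1 makes the two sides match at x = L, so no singular part arises there. -/
theorem HasStripGreenX.hasPlaneWeakDeriv {L c₁ c₂ : ℝ} {a ax : ℝ × ℝ → ℝ}
    (h : HasStripGreenX L a ax) (ha : MemLp a 2 (stripMeasure L))
    (hax : MemLp ax 2 (stripMeasure L)) (hc : c₁ + c₂ = 1) :
    HasPlaneWeakDeriv (1, 0) (reflectSum L c₁ c₂ ((strip L).indicator a))
      (reflectSum L (-c₁) (-2 * c₂) ((strip L).indicator ax)) := by
  intro η hη hη'
  have hη₁ := memLp_of_contDiff (contDiff_fderiv_apply_const hη (1, 0))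
    (hasCompactSupport_fderiv_apply_const hη' (1, 0))
  rw [integral_reflectSum_mul (memLp_indicator_strip ha) hη₁,
    integral_reflectSum_mul (memLp_indicator_strip hax) (memLp_of_contDiff hη hη'),
    integral_indicator_strip_mul, integral_indicator_strip_mul]
  -- This test function has the x-derivative required by the adjoint formula, and it vanishes on x =
  -- L since 1 - c₁ - c₂ = 0.
  have key := h (fun w => η w + -c₁ * η (reflectAcross L 1 w) + -c₂ * η (reflectAcross L 2⁻¹ w))
    (contDiff_reflect_combination hη _ _ _) (hasCompactSupport_reflect_combination hη' _ _ _)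
    (fun y => by
      simp only [reflectAcross, sub_self, mul_zero, sub_zero]
      linear_combination (-(η (L, y))) * hc)
  have hneg : ∀ (t : ℝ) (z : ℝ × ℝ), fderiv ℝ η z (t, 0) = t * fderiv ℝ η z (1, 0) := by
    intro t z
    rw [← smul_eq_mul, ← map_smul]; simp
  simp only [fderiv_reflect_combination hη, hneg (-1 * 1), hneg (-2⁻¹ * 1)] at key
  refine Eq.trans (integral_congr_ae (ae_of_all _ fun z => ?_))
    (key.trans (congrArg Neg.neg (integral_congr_ae (ae_of_all _ fun z => ?_))))
  · simp only
    ring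
  · simp only
    ring

theorem HasStripGreenY.hasPlaneWeakDeriv {L c₁ c₂ : ℝ} {a ay : ℝ × ℝ → ℝ}
    (h : HasStripGreenY L a ay) (ha : MemLp a 2 (stripMeasure L))
    (hay : MemLp ay 2 (stripMeasure L)) :
    HasPlaneWeakDeriv (0, 1) (reflectSum L c₁ c₂ ((strip L).indicator a))
      (reflectSum L c₁ c₂ ((strip L).indicator ay)) := by
  intro η hη hη'
  have hη₁ := memLp_of_contDiff (contDiff_fderiv_apply_const hη (0, 1))
    (hasCompactSupport_fderiv_apply_const hη' (0, 1))
  rw [integral_reflectSum_mul (memLp_indicator_strip ha) hη₁,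
    integral_reflectSum_mul (memLp_indicator_strip hay) (memLp_of_contDiff hη hη'),
    integral_indicator_strip_mul, integral_indicator_strip_mul]
  have key := h (fun w => η w + c₁ * η (reflectAcross L 1 w) + c₂ / 2 * η (reflectAcross L 2⁻¹ w))
    (contDiff_reflect_combination hη _ _ _) (hasCompactSupport_reflect_combination hη' _ _ _)
  simpa only [fderiv_reflect_combination hη, mul_zero] using key

/-- Korn's inequality on the strip, clamped on all sides except `x = L`; the constant does not
depend on the width. -/
theorem strip_korn {L ε : ℝ} {a ax ay b bx bY : ℝ × ℝ → ℝ} (hε : 0 ≤ ε)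
    (ha : MemLp a 2 (stripMeasure L)) (hax : MemLp ax 2 (stripMeasure L))
    (hay : MemLp ay 2 (stripMeasure L)) (hb : MemLp b 2 (stripMeasure L))
    (hbx : MemLp bx 2 (stripMeasure L)) (hbY : MemLp bY 2 (stripMeasure L))
    (gax : HasStripGreenX L a ax) (gay : HasStripGreenY L a ay)
    (gbx : HasStripGreenX L b bx) (gbY : HasStripGreenY L b bY) :
    (∫ z in strip L, ay z ^ 2) + ε ^ 2 * (∫ z in strip L, bx z ^ 2) ≤
      126 * ((∫ z in strip L, (ay z - ε * bx z) ^ 2) +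
        ε * ((∫ z in strip L, ax z ^ 2) + ∫ z in strip L, bY z ^ 2)) := by
  have mE : MemLp (fun z => ay z - ε * bx z) 2 (stripMeasure L) := hay.sub (hbx.const_mul ε)
  have ia := memLp_indicator_strip ha
  have iax := memLp_indicator_strip hax
  have iay := memLp_indicator_strip hay
  have ib := memLp_indicator_strip hb
  have ibx := memLp_indicator_strip hbx
  have ibY := memLp_indicator_strip hbY
  have iE := memLp_indicator_strip mE
  -- With (-3, 4) for a and (3, -2) for b, both pairs sum to 1, and the x-derivative of the extended
  -- b carries (-3, 4), the same coefficients as the y-derivative of the extended a.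
  have dax := gax.hasPlaneWeakDeriv (c₁ := -3) (c₂ := 4) ha hax (by norm_num)
  have day := gay.hasPlaneWeakDeriv (c₁ := -3) (c₂ := 4) ha hay
  have dbx := gbx.hasPlaneWeakDeriv (c₁ := 3) (c₂ := -2) hb hbx (by norm_num)
  have dbY := gbY.hasPlaneWeakDeriv (c₁ := 3) (c₂ := -2) hb hbY
  norm_num at dax dbx
  have key := plane_korn hε (ia.reflectSum L _ _) (iax.reflectSum L _ _) (iay.reflectSum L _ _)
    (ib.reflectSum L _ _) (ibx.reflectSum L _ _) (ibY.reflectSum L _ _) dax day dbx dbY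
  -- For a point of the strip both reflected points lie beyond x = L, so the extension restricts to
  -- the original function.
  have lower : ∀ {H : ℝ × ℝ → ℝ} (c₁ c₂ : ℝ), MemLp H 2 (stripMeasure L) →
      ∫ z in strip L, H z ^ 2 ≤ ∫ z, reflectSum L c₁ c₂ ((strip L).indicator H) z ^ 2 := by
    intro H c₁ c₂ hH
    rw [← integral_indicator (measurableSet_strip L)]
    refine integral_mono ((integrable_indicator_iff (measurableSet_strip L)).2 hH.integrable_sq)
      ((memLp_indicator_strip hH).reflectSum L c₁ c₂).integrable_sq fun z => ?_
    by_cases hz : z ∈ strip L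
    · have hz1 : z.1 < L := hz.1.2
      have n1 : reflectAcross L 1 z ∉ strip L := fun h => by
        have : L - 1 * (z.1 - L) < L := h.1.2
        linarith
      have n2 : reflectAcross L 2 z ∉ strip L := fun h => by
        have : L - 2 * (z.1 - L) < L := h.1.2
        linarith
      simp [reflectSum, hz, n1, n2]
    · simp only [Set.indicator_of_notMem hz]
      positivity
  have l1 := lower (-3) 4 hay
  have eE : ∀ z, reflectSum L (-3) 4 ((strip L).indicator ay) z -
      ε * reflectSum L (-3) 4 ((strip L).indicator bx) z =
      reflectSum L (-3) 4 ((strip L).indicator fun z => ay z - ε * bx z) z := by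
    intro z
    have : ∀ w, (strip L).indicator (fun z => ay z - ε * bx z) w =
        (strip L).indicator ay w - ε * (strip L).indicator bx w := by
      intro w
      by_cases hw : w ∈ strip L <;> simp [hw]
    simp only [reflectSum, this]
    ring
  simp only [eE] at key
  have l2 := lower (-3) 4 hbx
  -- The bounds are 54, 126 and 36; the largest is the final constant.
  have u1 := integral_reflectSum_sq_le iE L (-3) 4
  have u2 := integral_reflectSum_sq_le iax L 3 (-8)
  have u3 := integral_reflectSum_sq_le ibY L 3 (-2)
  rw [integral_indicator_strip_sq] at u1 u2 u3
  have p1 : 0 ≤ ∫ z in strip L, (ay z - ε * bx z) ^ 2 := integral_nonneg fun z => sq_nonneg _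
  have p2 : 0 ≤ ∫ z in strip L, ax z ^ 2 := integral_nonneg fun z => sq_nonneg _
  have p3 : 0 ≤ ∫ z in strip L, bY z ^ 2 := integral_nonneg fun z => sq_nonneg _
  have v := mul_le_mul_of_nonneg_left (add_le_add u2 u3) hε
  have l2' := mul_le_mul_of_nonneg_left l2 (sq_nonneg ε)
  have q2 := mul_nonneg hε p2
  have q3 := mul_nonneg hε p3
  nlinarith

/-! ### Smooth cutoffs -/

theorem deriv_smoothTransition_eq_zero {t : ℝ} (h : t ≤ 0 ∨ 1 ≤ t) :
    deriv Real.smoothTransition t = 0 := by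
  rcases h with h | h
  · refine IsLocalMin.deriv_eq_zero (Eventually.of_forall fun s => ?_)
    rw [Real.smoothTransition.zero_of_nonpos h]
    exact Real.smoothTransition.nonneg s
  · refine IsLocalMax.deriv_eq_zero (Eventually.of_forall fun s => ?_)
    rw [Real.smoothTransition.one_of_one_le h]
    exact Real.smoothTransition.le_one s

/-- A smooth cutoff which vanishes for `k t ≤ 1` and equals `1` for `k t ≥ 2`. -/
noncomputable def smoothCutoff (k t : ℝ) : ℝ := Real.smoothTransition (k * t - 1)

theorem contDiff_smoothCutoff (k : ℝ) : ContDiff ℝ ∞ (smoothCutoff k) :=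
  Real.smoothTransition.contDiff.comp ((contDiff_const.mul contDiff_id).sub contDiff_const)

theorem smoothCutoff_nonneg (k t : ℝ) : 0 ≤ smoothCutoff k t := Real.smoothTransition.nonneg _

theorem smoothCutoff_le_one (k t : ℝ) : smoothCutoff k t ≤ 1 := Real.smoothTransition.le_one _

theorem abs_smoothCutoff_le_one (k t : ℝ) : |smoothCutoff k t| ≤ 1 := by
  rw [abs_of_nonneg (smoothCutoff_nonneg k t)]
  exact smoothCutoff_le_one k t

theorem smoothCutoff_eq_zero {k t : ℝ} (h : k * t ≤ 1) : smoothCutoff k t = 0 :=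
  Real.smoothTransition.zero_of_nonpos (by linarith)

theorem smoothCutoff_eq_one {k t : ℝ} (h : 2 ≤ k * t) : smoothCutoff k t = 1 :=
  Real.smoothTransition.one_of_one_le (by linarith)

theorem deriv_smoothCutoff (k t : ℝ) :
    deriv (smoothCutoff k) t = k * deriv Real.smoothTransition (k * t - 1) := by
  have h1 : HasDerivAt (fun t : ℝ => k * t - 1) k t := by
    simpa using ((hasDerivAt_id t).const_mul k).sub_const 1
  have h2 := (((Real.smoothTransition.contDiff (n := 1)).differentiable (by simp))
    (k * t - 1)).hasDerivAt
  have h3 : HasDerivAt (smoothCutoff k) _ t := h2.comp t h1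
  rw [h3.deriv]
  ring

theorem deriv_smoothCutoff_eq_zero {k t : ℝ} (h : 2 ≤ k * t) : deriv (smoothCutoff k) t = 0 := by
  rw [deriv_smoothCutoff, deriv_smoothTransition_eq_zero (Or.inr (by linarith)), mul_zero]

/-- The quantity t χ_k'(t) depends only on r = k t and vanishes unless 1 ≤ r ≤ 2, hence the bound
uniform in k. -/
theorem exists_abs_mul_deriv_smoothCutoff_le :
    ∃ C : ℝ, 0 ≤ C ∧ ∀ k t : ℝ, |t * deriv (smoothCutoff k) t| ≤ C := by
  have hc : Continuous (deriv Real.smoothTransition) :=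
    (Real.smoothTransition.contDiff (n := 1)).continuous_deriv (by simp)
  obtain ⟨C, hC⟩ := (isCompact_Icc (a := (1 : ℝ)) (b := 2)).exists_bound_of_continuousOn
    (f := fun r => r * deriv Real.smoothTransition (r - 1)) (by fun_prop)
  refine ⟨max C 0, le_max_right _ _, fun k t => ?_⟩
  rw [deriv_smoothCutoff]
  by_cases h : k * t ∈ Icc (1 : ℝ) 2
  · have := hC _ h
    rw [Real.norm_eq_abs] at this
    calc _ = |k * t * deriv Real.smoothTransition (k * t - 1)| := by congr 1; ring
      _ ≤ _ := this.trans (le_max_left _ _)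
  · rw [deriv_smoothTransition_eq_zero]
    · simp
    · by_contra hcon
      push Not at hcon
      exact h ⟨by linarith, by linarith⟩

theorem eventually_two_le_mul {t : ℝ} (ht : 0 < t) : ∀ᶠ n : ℕ in atTop, 2 ≤ ((n : ℝ) + 1) * t := by
  have h : Tendsto (fun n : ℕ => ((n : ℝ) + 1) * t) atTop atTop :=
    (tendsto_atTop_add_const_right _ _ tendsto_natCast_atTop_atTop).atTop_mul_const ht
  exact h.eventually_ge_atTop 2

theorem tendsto_smoothCutoff {t : ℝ} (ht : 0 < t) :
    Tendsto (fun n : ℕ => smoothCutoff (n + 1) t) atTop (𝓝 1) :=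
  tendsto_const_nhds.congr'
    ((eventually_two_le_mul ht).mono fun _ h => (smoothCutoff_eq_one h).symm)

theorem tendsto_deriv_smoothCutoff {t : ℝ} (ht : 0 < t) :
    Tendsto (fun n : ℕ => deriv (smoothCutoff (n + 1)) t) atTop (𝓝 0) :=
  tendsto_const_nhds.congr'
    ((eventually_two_le_mul ht).mono fun _ h => (deriv_smoothCutoff_eq_zero h).symm)

/-! ### Green formulas up to the boundary by multiplication by y -/

/-- A smooth function with compact support in the strip. -/
def IsStripTest (L : ℝ) (η : ℝ × ℝ → ℝ) : Prop :=
  ContDiff ℝ ∞ η ∧ HasCompactSupport η ∧ tsupport η ⊆ strip L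

theorem fderiv_tensor_mul {A B : ℝ → ℝ} {ζ : ℝ × ℝ → ℝ} (hA : ContDiff ℝ ∞ A)
    (hB : ContDiff ℝ ∞ B) (hζ : ContDiff ℝ ∞ ζ) (z e : ℝ × ℝ) :
    fderiv ℝ (fun w => A w.1 * B w.2 * ζ w) z e =
      A z.1 * B z.2 * fderiv ℝ ζ z e +
        (deriv A z.1 * e.1 * B z.2 + A z.1 * (deriv B z.2 * e.2)) * ζ z := by
  have h1 : HasFDerivAt (fun w : ℝ × ℝ => A w.1) _ z :=
    ((hA.differentiable (by simp)) z.1).hasDerivAt.comp_hasFDerivAt z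
      (hasFDerivAt_fst (𝕜 := ℝ))
  have h2 : HasFDerivAt (fun w : ℝ × ℝ => B w.2) _ z :=
    ((hB.differentiable (by simp)) z.2).hasDerivAt.comp_hasFDerivAt z
      (hasFDerivAt_snd (𝕜 := ℝ))
  have h : HasFDerivAt (fun w => A w.1 * B w.2 * ζ w) _ z :=
    (h1.mul h2).mul ((hζ.differentiable (by simp)) z).hasFDerivAt
  rw [h.fderiv]
  simp
  ring

theorem contDiff_tensor_mul {A B : ℝ → ℝ} {ζ : ℝ × ℝ → ℝ} (hA : ContDiff ℝ ∞ A)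
    (hB : ContDiff ℝ ∞ B) (hζ : ContDiff ℝ ∞ ζ) :
    ContDiff ℝ ∞ (fun w : ℝ × ℝ => A w.1 * B w.2 * ζ w) :=
  ((hA.comp contDiff_fst).mul (hB.comp contDiff_snd)).mul hζ

theorem tsupport_subset_of_isClosed {f : ℝ × ℝ → ℝ} {K : Set (ℝ × ℝ)} (hK : IsClosed K)
    (h : ∀ z, f z ≠ 0 → z ∈ K) : tsupport f ⊆ K :=
  closure_minimal h hK

theorem isClosed_one_le {f : ℝ × ℝ → ℝ} (hf : Continuous f) : IsClosed {z | 1 ≤ f z} :=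
  isClosed_le continuous_const hf

theorem lt_mul_of_smoothCutoff_ne_zero {k t : ℝ} (h : smoothCutoff k t ≠ 0) : 1 ≤ k * t := by
  by_contra hcon
  exact h (smoothCutoff_eq_zero (by linarith))

theorem pos_of_one_le_natCast_mul {n : ℕ} {t : ℝ} (h : 1 ≤ ((n : ℝ) + 1) * t) : 0 < t := by
  by_contra hcon
  push Not at hcon
  have : ((n : ℝ) + 1) * t ≤ 0 := mul_nonpos_of_nonneg_of_nonpos (by positivity) hcon
  linarith

/-- Dominated convergence for a square integrable function against uniformly bounded multipliers
supported in a fixed compact set. -/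
theorem tendsto_integral_mul_of_bounded {L c : ℝ} {H m : ℝ × ℝ → ℝ} {M : ℕ → ℝ × ℝ → ℝ}
    {K : Set (ℝ × ℝ)} (hH : MemLp H 2 (stripMeasure L)) (hK : IsCompact K)
    (hM : ∀ n, Measurable (M n)) (hb : ∀ n, ∀ z ∈ strip L, |M n z| ≤ K.indicator (fun _ => c) z)
    (hlim : ∀ z ∈ strip L, Tendsto (fun n => M n z) atTop (𝓝 (m z))) :
    Tendsto (fun n => ∫ z in strip L, H z * M n z) atTop (𝓝 (∫ z in strip L, H z * m z)) := by
  have hc : MemLp (K.indicator fun _ => c) 2 (stripMeasure L) :=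
    memLp_indicator_const 2 hK.measurableSet c
      (Or.inr ((Measure.restrict_apply_le _ _).trans_lt hK.measure_lt_top).ne)
  refine tendsto_integral_of_dominated_convergence
    (fun z => |H z| * K.indicator (fun _ => c) z) (fun n => hH.1.mul (hM n).aestronglyMeasurable)
    (hH.abs.integrable_mul hc) (fun n => ?_) ?_
  · filter_upwards [ae_restrict_mem (measurableSet_strip L)] with z hz
    rw [Real.norm_eq_abs, abs_mul]
    exact mul_le_mul_of_nonneg_left (hb n z hz) (abs_nonneg _)
  · filter_upwards [ae_restrict_mem (measurableSet_strip L)] with z hz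
    exact (hlim z hz).const_mul _

theorem integrableOn_mul_of_hasCompactSupport {L : ℝ} {H m : ℝ × ℝ → ℝ}
    (hH : MemLp H 2 (stripMeasure L)) (hm : Continuous m) (hm' : HasCompactSupport m) :
    IntegrableOn (fun z => H z * m z) (strip L) := by
  have h : MemLp m 2 (stripMeasure L) :=
    (hm.memLp_of_hasCompactSupport (μ := volume) (p := 2) hm').restrict _
  exact hH.integrable_mul h

theorem exists_abs_le_indicator {ζ : ℝ × ℝ → ℝ} (h : Continuous ζ) (hc : HasCompactSupport ζ)
    {K : Set (ℝ × ℝ)} (hK : tsupport ζ ⊆ K) :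
    ∃ c, 0 ≤ c ∧ ∀ z, |ζ z| ≤ K.indicator (fun _ => c) z := by
  obtain ⟨c, hc⟩ := hc.exists_bound_of_continuous h
  refine ⟨max c 0, le_max_right _ _, fun z => ?_⟩
  by_cases hz : z ∈ K
  · rw [Set.indicator_of_mem hz]
    exact (hc z).trans (le_max_left _ _)
  · rw [Set.indicator_of_notMem hz, image_eq_zero_of_notMem_tsupport fun h => hz (hK h), abs_zero]

theorem abs_mul_le_indicator {K : Set (ℝ × ℝ)} {c d s t : ℝ} {z : ℝ × ℝ} (hd : 0 ≤ d)
    (hs : |s| ≤ d) (ht : |t| ≤ K.indicator (fun _ => c) z) :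
    |s * t| ≤ K.indicator (fun _ => d * c) z := by
  rw [abs_mul]
  by_cases hz : z ∈ K
  · rw [Set.indicator_of_mem hz] at ht ⊢
    exact mul_le_mul hs ht (abs_nonneg _) hd
  · rw [Set.indicator_of_notMem hz] at ht ⊢
    rw [le_antisymm ht (abs_nonneg _), mul_zero]

theorem deriv_id_mul_smoothCutoff (k t : ℝ) :
    deriv (fun s => s * smoothCutoff k s) t =
      smoothCutoff k t + t * deriv (smoothCutoff k) t := by
  have h := (hasDerivAt_id t).mul
    ((contDiff_smoothCutoff k).differentiable (by simp) t).hasDerivAt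
  have h' : HasDerivAt (fun s => s * smoothCutoff k s) _ t := h
  rw [h'.deriv]
  simp

theorem contDiff_id_mul_smoothCutoff (k : ℝ) : ContDiff ℝ ∞ fun s => s * smoothCutoff k s :=
  contDiff_id.mul (contDiff_smoothCutoff k)

theorem tsupport_fderiv_apply_subset_tsupport (ζ : ℝ × ℝ → ℝ) (e : ℝ × ℝ) :
    tsupport (fun z => fderiv ℝ ζ z e) ⊆ tsupport ζ :=
  tsupport_fderiv_apply_subset ℝ e

theorem abs_mul_le_one {s t : ℝ} (hs : |s| ≤ 1) (ht : |t| ≤ 1) : |s * t| ≤ 1 := by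
  rw [abs_mul]
  exact mul_le_one₀ hs (abs_nonneg _) ht

/-- Multiplication by `y` turns an interior weak `y`-derivative into one that ignores the
boundary. -/
theorem hasStripGreenY_mul {L : ℝ} {f h : ℝ × ℝ → ℝ} (hf : MemLp f 2 (stripMeasure L))
    (hyf : MemLp (fun z => z.2 * f z) 2 (stripMeasure L))
    (hyh : MemLp (fun z => z.2 * h z) 2 (stripMeasure L))
    (hw : ∀ η, IsStripTest L η →
      ∫ z in strip L, f z * fderiv ℝ η z (0, 1) = -∫ z in strip L, h z * η z) :
    HasStripGreenY L (fun z => z.2 * f z) (fun z => f z + z.2 * h z) := by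
  intro ζ hζ hζ'
  obtain ⟨C, hC0, hC⟩ := exists_abs_mul_deriv_smoothCutoff_le
  -- The x-cutoff A is never differentiated here. In y the cutoff is multiplied by y, so its
  -- derivative stays bounded and tends to 1, which produces the extra term f.
  set A : ℕ → ℝ → ℝ := fun n x => smoothCutoff (n + 1) x * smoothCutoff (n + 1) (L - x) with hA
  set B : ℕ → ℝ → ℝ := fun n y => y * smoothCutoff (n + 1) y with hB
  have cA : ∀ n, ContDiff ℝ ∞ (A n) := fun n =>
    (contDiff_smoothCutoff _).mul ((contDiff_smoothCutoff _).comp (contDiff_const.sub contDiff_id))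
  have cB : ∀ n, ContDiff ℝ ∞ (B n) := fun n => contDiff_id_mul_smoothCutoff _
  have bA : ∀ n x, |A n x| ≤ 1 := fun n x =>
    abs_mul_le_one (abs_smoothCutoff_le_one _ _) (abs_smoothCutoff_le_one _ _)
  have lA : ∀ z ∈ strip L, Tendsto (fun n => A n z.1) atTop (𝓝 1) := fun z hz => by
    simpa using (tendsto_smoothCutoff hz.1.1).mul (tendsto_smoothCutoff (sub_pos.2 hz.1.2))
  have test : ∀ n, IsStripTest L (fun w => A n w.1 * B n w.2 * ζ w) := by
    intro n
    refine ⟨contDiff_tensor_mul (cA n) (cB n) hζ, hζ'.mul_left, ?_⟩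
    have hcl : IsClosed {z : ℝ × ℝ | 1 ≤ ((n : ℝ) + 1) * z.1 ∧ 1 ≤ ((n : ℝ) + 1) * (L - z.1) ∧
        1 ≤ ((n : ℝ) + 1) * z.2} :=
      (isClosed_one_le (f := fun z => ((n : ℝ) + 1) * z.1) (by fun_prop)).inter
        ((isClosed_one_le (f := fun z => ((n : ℝ) + 1) * (L - z.1)) (by fun_prop)).inter
        (isClosed_one_le (f := fun z => ((n : ℝ) + 1) * z.2) (by fun_prop)))
    refine (tsupport_subset_of_isClosed hcl fun z hz => ?_).trans fun z hz =>
      ⟨⟨pos_of_one_le_natCast_mul hz.1, sub_pos.1 (pos_of_one_le_natCast_mul hz.2.1)⟩,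
        pos_of_one_le_natCast_mul hz.2.2⟩
    simp only [hA, hB, ne_eq, mul_eq_zero, not_or] at hz
    exact ⟨lt_mul_of_smoothCutoff_ne_zero hz.1.1.1, lt_mul_of_smoothCutoff_ne_zero hz.1.1.2,
      lt_mul_of_smoothCutoff_ne_zero hz.1.2.2⟩
  have hζ₂ := contDiff_fderiv_apply_const hζ (0, 1)
  have hζ₂' := hasCompactSupport_fderiv_apply_const hζ' (0, 1)
  obtain ⟨c, hc0, hc⟩ := exists_abs_le_indicator hζ.continuous hζ' subset_rfl
  obtain ⟨c₂, -, hc₂⟩ := exists_abs_le_indicator hζ₂.continuous hζ₂'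
    (tsupport_fderiv_apply_subset_tsupport ζ (0, 1))
  have hK : IsCompact (tsupport ζ) := hζ'
  have mA : ∀ n, Measurable fun z : ℝ × ℝ => A n z.1 := fun n =>
    (cA n).continuous.measurable.comp measurable_fst
  have mc : ∀ n : ℕ, Measurable fun z : ℝ × ℝ => smoothCutoff (n + 1) z.2 := fun n =>
    (contDiff_smoothCutoff _).continuous.measurable.comp measurable_snd
  have mB : ∀ n, Measurable fun z : ℝ × ℝ => deriv (B n) z.2 := fun n =>
    (measurable_deriv _).comp measurable_snd
  have b1 : ∀ (n : ℕ) (z : ℝ × ℝ), |A n z.1 * smoothCutoff (n + 1) z.2| ≤ 1 := fun n z =>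
    abs_mul_le_one (bA _ _) (abs_smoothCutoff_le_one _ _)
  have l1 : ∀ z ∈ strip L, Tendsto (fun n : ℕ => A n z.1 * smoothCutoff (n + 1) z.2) atTop
      (𝓝 1) := fun z hz => by
    simpa using (lA z hz).mul (tendsto_smoothCutoff hz.2)
  have t1 := tendsto_integral_mul_of_bounded (m := fun z => fderiv ℝ ζ z (0, 1))
    (M := fun n z => A n z.1 * smoothCutoff (n + 1) z.2 * fderiv ℝ ζ z (0, 1)) hyf hK
    (fun n => ((mA n).mul (mc n)).mul hζ₂.continuous.measurable)
    (fun n z _ => abs_mul_le_indicator zero_le_one (b1 n z) (hc₂ z))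
    (fun z hz => by simpa using (l1 z hz).mul_const (fderiv ℝ ζ z (0, 1)))
  have t2 := tendsto_integral_mul_of_bounded (m := ζ) (c := (1 + C) * c)
    (M := fun n z => A n z.1 * deriv (B n) z.2 * ζ z) hf hK
    (fun n => ((mA n).mul (mB n)).mul hζ.continuous.measurable)
    (fun n z _ => by
      refine abs_mul_le_indicator (by positivity) ?_ (hc z)
      rw [abs_mul, ← one_mul (1 + C)]
      refine mul_le_mul (bA _ _) ?_ (abs_nonneg _) zero_le_one
      simp only [hB, deriv_id_mul_smoothCutoff]
      exact (abs_add_le _ _).trans (add_le_add (abs_smoothCutoff_le_one _ _) (hC _ _)))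
    (fun z hz => by
      have : Tendsto (fun n => deriv (B n) z.2) atTop (𝓝 1) := by
        simp only [hB, deriv_id_mul_smoothCutoff]
        simpa using (tendsto_smoothCutoff hz.2).add
          ((tendsto_deriv_smoothCutoff hz.2).const_mul z.2)
      simpa using ((lA z hz).mul this).mul_const (ζ z))
  have t3 := tendsto_integral_mul_of_bounded (m := ζ)
    (M := fun n z => A n z.1 * smoothCutoff (n + 1) z.2 * ζ z) hyh hK
    (fun n => ((mA n).mul (mc n)).mul hζ.continuous.measurable)
    (fun n z _ => abs_mul_le_indicator zero_le_one (b1 n z) (hc z))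
    (fun z hz => by simpa using (l1 z hz).mul_const (ζ z))
  have eqn : ∀ n, (∫ z in strip L, z.2 * f z *
        (A n z.1 * smoothCutoff (n + 1) z.2 * fderiv ℝ ζ z (0, 1))) +
      (∫ z in strip L, f z * (A n z.1 * deriv (B n) z.2 * ζ z)) =
      -∫ z in strip L, z.2 * h z * (A n z.1 * smoothCutoff (n + 1) z.2 * ζ z) := by
    intro n
    have cA' : Continuous fun z : ℝ × ℝ => A n z.1 := (cA n).continuous.comp continuous_fst
    have cc' : Continuous fun z : ℝ × ℝ => smoothCutoff (n + 1) z.2 :=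
      (contDiff_smoothCutoff _).continuous.comp continuous_snd
    have cB' : Continuous fun z : ℝ × ℝ => deriv (B n) z.2 :=
      ((cB n).continuous_deriv (by simp)).comp continuous_snd
    refine (integral_add
      (integrableOn_mul_of_hasCompactSupport hyf ((cA'.mul cc').mul hζ₂.continuous) hζ₂'.mul_left)
      (integrableOn_mul_of_hasCompactSupport hf ((cA'.mul cB').mul hζ.continuous)
        hζ'.mul_left)).symm.trans ?_
    have := hw _ (test n)
    simp only [fderiv_tensor_mul (cA n) (cB n) hζ] at this
    refine Eq.trans (integral_congr_ae (ae_of_all _ fun z => ?_))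
      (this.trans (congrArg Neg.neg (integral_congr_ae (ae_of_all _ fun z => ?_))))
    · simp only [hB, Pi.mul_apply]; ring
    · simp only [hB]; ring
  have lim := tendsto_nhds_unique ((t1.add t2).congr eqn) t3.neg
  have split : ∫ z in strip L, (f z + z.2 * h z) * ζ z =
      (∫ z in strip L, f z * ζ z) + ∫ z in strip L, z.2 * h z * ζ z := by
    rw [← integral_add (integrableOn_mul_of_hasCompactSupport hf hζ.continuous hζ')
      (integrableOn_mul_of_hasCompactSupport hyh hζ.continuous hζ')]
    simp only [add_mul]
  rw [split]
  linarith

theorem exists_abs_le_mul_of_eq_zero {ζ : ℝ × ℝ → ℝ} (hζ : ContDiff ℝ ∞ ζ)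
    (hζ' : HasCompactSupport ζ) :
    ∃ M : ℝ, 0 ≤ M ∧ ∀ z w : ℝ × ℝ, ζ w = 0 → |ζ z| ≤ M * ‖z - w‖ := by
  obtain ⟨M, hM⟩ := ContDiff.lipschitzWith_of_hasCompactSupport hζ' hζ (by simp)
  refine ⟨M, M.2, fun z w hw => ?_⟩
  have := hM.norm_sub_le z w
  rwa [hw, sub_zero] at this

/-- Multiplication by `y`, and testing with functions that vanish at `x = L`, turns a weak
`x`-derivative across `x = 0` into one that ignores the boundary. -/
theorem hasStripGreenX_mul {L : ℝ} {f g : ℝ × ℝ → ℝ}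
    (hyf : MemLp (fun z => z.2 * f z) 2 (stripMeasure L))
    (hyg : MemLp (fun z => z.2 * g z) 2 (stripMeasure L))
    (hw : ∀ η : ℝ × ℝ → ℝ, ContDiff ℝ ∞ η → HasCompactSupport η →
      tsupport η ⊆ Iio L ×ˢ Ioi 0 →
      ∫ z in strip L, f z * fderiv ℝ η z (1, 0) = -∫ z in strip L, g z * η z) :
    HasStripGreenX L (fun z => z.2 * f z) (fun z => z.2 * g z) := by
  intro ζ hζ hζ' hζ0
  obtain ⟨C, hC0, hC⟩ := exists_abs_mul_deriv_smoothCutoff_le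
  obtain ⟨M, hM0, hM⟩ := exists_abs_le_mul_of_eq_zero hζ hζ'
  set A : ℕ → ℝ → ℝ := fun n x => smoothCutoff (n + 1) (L - x) with hA
  set B : ℕ → ℝ → ℝ := fun n y => y * smoothCutoff (n + 1) y with hB
  have cA : ∀ n, ContDiff ℝ ∞ (A n) := fun n =>
    (contDiff_smoothCutoff _).comp (contDiff_const.sub contDiff_id)
  have cB : ∀ n, ContDiff ℝ ∞ (B n) := fun n => contDiff_id_mul_smoothCutoff _
  have bA : ∀ n x, |A n x| ≤ 1 := fun n x => abs_smoothCutoff_le_one _ _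
  have dA : ∀ n x, deriv (A n) x = -deriv (smoothCutoff (n + 1)) (L - x) := fun n x => by
    simp only [hA]
    rw [deriv_comp_const_sub]
  have lA : ∀ z ∈ strip L, Tendsto (fun n => A n z.1) atTop (𝓝 1) := fun z hz =>
    tendsto_smoothCutoff (sub_pos.2 hz.1.2)
  have test : ∀ n, tsupport (fun w => A n w.1 * B n w.2 * ζ w) ⊆ Iio L ×ˢ Ioi 0 := by
    intro n
    have hcl : IsClosed {z : ℝ × ℝ | 1 ≤ ((n : ℝ) + 1) * (L - z.1) ∧
        1 ≤ ((n : ℝ) + 1) * z.2} :=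
      (isClosed_one_le (f := fun z => ((n : ℝ) + 1) * (L - z.1)) (by fun_prop)).inter
        (isClosed_one_le (f := fun z => ((n : ℝ) + 1) * z.2) (by fun_prop))
    refine (tsupport_subset_of_isClosed hcl fun z hz => ?_).trans fun z hz =>
      ⟨sub_pos.1 (pos_of_one_le_natCast_mul hz.1), pos_of_one_le_natCast_mul hz.2⟩
    simp only [hA, hB, ne_eq, mul_eq_zero, not_or] at hz
    exact ⟨lt_mul_of_smoothCutoff_ne_zero hz.1.1, lt_mul_of_smoothCutoff_ne_zero hz.1.2.2⟩
  have hζ₂ := contDiff_fderiv_apply_const hζ (1, 0)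
  have hζ₂' := hasCompactSupport_fderiv_apply_const hζ' (1, 0)
  obtain ⟨c, hc0, hc⟩ := exists_abs_le_indicator hζ.continuous hζ' subset_rfl
  obtain ⟨c₂, -, hc₂⟩ := exists_abs_le_indicator hζ₂.continuous hζ₂'
    (tsupport_fderiv_apply_subset_tsupport ζ (1, 0))
  have hK : IsCompact (tsupport ζ) := hζ'
  have mA : ∀ n, Measurable fun z : ℝ × ℝ => A n z.1 := fun n =>
    (cA n).continuous.measurable.comp measurable_fst
  have mA' : ∀ n, Measurable fun z : ℝ × ℝ => deriv (A n) z.1 := fun n =>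
    (measurable_deriv _).comp measurable_fst
  have mc : ∀ n : ℕ, Measurable fun z : ℝ × ℝ => smoothCutoff (n + 1) z.2 := fun n =>
    (contDiff_smoothCutoff _).continuous.measurable.comp measurable_snd
  have b1 : ∀ (n : ℕ) (z : ℝ × ℝ), |A n z.1 * smoothCutoff (n + 1) z.2| ≤ 1 := fun n z =>
    abs_mul_le_one (bA _ _) (abs_smoothCutoff_le_one _ _)
  have l1 : ∀ z ∈ strip L, Tendsto (fun n : ℕ => A n z.1 * smoothCutoff (n + 1) z.2) atTop
      (𝓝 1) := fun z hz => by
    simpa using (lA z hz).mul (tendsto_smoothCutoff hz.2)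
  have t1 := tendsto_integral_mul_of_bounded (m := fun z => fderiv ℝ ζ z (1, 0))
    (M := fun n z => A n z.1 * smoothCutoff (n + 1) z.2 * fderiv ℝ ζ z (1, 0)) hyf hK
    (fun n => ((mA n).mul (mc n)).mul hζ₂.continuous.measurable)
    (fun n z _ => abs_mul_le_indicator zero_le_one (b1 n z) (hc₂ z))
    (fun z hz => by simpa using (l1 z hz).mul_const (fderiv ℝ ζ z (1, 0)))
  -- The derivative of the cutoff is of size 1/(L - x) near x = L, while ζ vanishes there and is
  -- Lipschitz, so the product is bounded uniformly in n.
  have bd : ∀ n z, |deriv (A n) z.1 * ζ z| ≤ (tsupport ζ).indicator (fun _ => C * M) z := by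
    intro n z
    by_cases hz : z ∈ tsupport ζ
    · rw [Set.indicator_of_mem hz, dA, abs_mul, abs_neg]
      have h1 : |ζ z| ≤ M * |L - z.1| := by
        have := hM z (L, z.2) (hζ0 _)
        simpa [Prod.norm_def, abs_sub_comm] using this
      have h2 := hC (n + 1) (L - z.1)
      rw [abs_mul] at h2
      calc _ ≤ |deriv (smoothCutoff (n + 1)) (L - z.1)| * (M * |L - z.1|) :=
            mul_le_mul_of_nonneg_left h1 (abs_nonneg _)
        _ = |L - z.1| * |deriv (smoothCutoff (n + 1)) (L - z.1)| * M := by ring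
        _ ≤ C * M := mul_le_mul_of_nonneg_right h2 hM0
    · rw [Set.indicator_of_notMem hz, image_eq_zero_of_notMem_tsupport hz, mul_zero, abs_zero]
  -- The commutator term tends to zero: at each point of the strip the derivative of the cutoff is
  -- eventually zero.
  have t2 := tendsto_integral_mul_of_bounded (m := 0)
    (M := fun n z => smoothCutoff (n + 1) z.2 * (deriv (A n) z.1 * ζ z)) hyf hK
    (fun n => (mc n).mul ((mA' n).mul hζ.continuous.measurable))
    (fun n z _ => abs_mul_le_indicator zero_le_one (abs_smoothCutoff_le_one _ _) (bd n z))
    (fun z hz => by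
      have : Tendsto (fun n => deriv (A n) z.1) atTop (𝓝 0) := by
        simp only [dA]
        simpa using (tendsto_deriv_smoothCutoff (sub_pos.2 hz.1.2)).neg
      simpa using (tendsto_smoothCutoff hz.2).mul (this.mul_const (ζ z)))
  have t3 := tendsto_integral_mul_of_bounded (m := ζ)
    (M := fun n z => A n z.1 * smoothCutoff (n + 1) z.2 * ζ z) hyg hK
    (fun n => ((mA n).mul (mc n)).mul hζ.continuous.measurable)
    (fun n z _ => abs_mul_le_indicator zero_le_one (b1 n z) (hc z))
    (fun z hz => by simpa using (l1 z hz).mul_const (ζ z))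
  have eqn : ∀ n, (∫ z in strip L, z.2 * f z *
        (A n z.1 * smoothCutoff (n + 1) z.2 * fderiv ℝ ζ z (1, 0))) +
      (∫ z in strip L, z.2 * f z * (smoothCutoff (n + 1) z.2 * (deriv (A n) z.1 * ζ z))) =
      -∫ z in strip L, z.2 * g z * (A n z.1 * smoothCutoff (n + 1) z.2 * ζ z) := by
    intro n
    have cA' : Continuous fun z : ℝ × ℝ => A n z.1 := (cA n).continuous.comp continuous_fst
    have cc' : Continuous fun z : ℝ × ℝ => smoothCutoff (n + 1) z.2 :=
      (contDiff_smoothCutoff _).continuous.comp continuous_snd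
    have cB' : Continuous fun z : ℝ × ℝ => deriv (A n) z.1 :=
      ((cA n).continuous_deriv (by simp)).comp continuous_fst
    refine (integral_add
      (integrableOn_mul_of_hasCompactSupport hyf ((cA'.mul cc').mul hζ₂.continuous) hζ₂'.mul_left)
      (integrableOn_mul_of_hasCompactSupport hyf (cc'.mul (cB'.mul hζ.continuous))
        hζ'.mul_left.mul_left)).symm.trans ?_
    have := hw _ (contDiff_tensor_mul (cA n) (cB n) hζ) hζ'.mul_left (test n)
    simp only [fderiv_tensor_mul (cA n) (cB n) hζ] at this
    refine Eq.trans (integral_congr_ae (ae_of_all _ fun z => ?_))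
      (this.trans (congrArg Neg.neg (integral_congr_ae (ae_of_all _ fun z => ?_))))
    · simp only [hB, Pi.mul_apply]; ring
    · simp only [hB]; ring
  have lim := tendsto_nhds_unique ((t1.add t2).congr eqn) t3.neg
  simpa using lim

/-! ### Weak derivatives across x = 0 for limits of test functions -/

theorem setIntegral_strip_mul_eq_integral {L : ℝ} {η : ℝ × ℝ → ℝ} (h : tsupport η ⊆ strip L)
    (f : ℝ × ℝ → ℝ) : ∫ z in strip L, f z * η z = ∫ z, f z * η z :=
  setIntegral_eq_integral_of_forall_compl_eq_zero fun z hz => by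
    rw [image_eq_zero_of_notMem_tsupport fun hz' => hz (h hz'), mul_zero]

theorem integral_contDiff_mul_fderiv {φ η : ℝ × ℝ → ℝ} (hφ : ContDiff ℝ ∞ φ)
    (hη : ContDiff ℝ ∞ η) (hη' : HasCompactSupport η) (e : ℝ × ℝ) :
    ∫ z, φ z * fderiv ℝ η z e = -∫ z, fderiv ℝ φ z e * η z := by
  have c1 := (contDiff_fderiv_apply_const hφ e).continuous
  have c2 := (contDiff_fderiv_apply_const hη e).continuous
  have s2 := hasCompactSupport_fderiv_apply_const hη' e
  exact integral_mul_fderiv_eq_neg_fderiv_mul_of_integrable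
    ((c1.mul hη.continuous).integrable_of_hasCompactSupport hη'.mul_left)
    ((hφ.continuous.mul c2).integrable_of_hasCompactSupport s2.mul_left)
    ((hφ.continuous.mul hη.continuous).integrable_of_hasCompactSupport hη'.mul_left)
    (fun z _ => hφ.differentiable (by simp) z) (fun z _ => hη.differentiable (by simp) z)

theorem integral_strip_contDiff_mul_fderiv {L : ℝ} {φ η : ℝ × ℝ → ℝ} (hφ : ContDiff ℝ ∞ φ)
    (hη : IsStripTest L η) (e : ℝ × ℝ) :
    ∫ z in strip L, φ z * fderiv ℝ η z e = -∫ z in strip L, fderiv ℝ φ z e * η z := by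
  rw [setIntegral_strip_mul_eq_integral hη.2.2, setIntegral_strip_mul_eq_integral
    ((tsupport_fderiv_apply_subset_tsupport η e).trans hη.2.2)]
  exact integral_contDiff_mul_fderiv hφ hη.1 hη.2.1 e

theorem isOpen_strip (L : ℝ) : IsOpen (strip L) := isOpen_Ioo.prod isOpen_Ioi

theorem fderiv_eq_zero_of_eq_zero_near_left {L δ : ℝ} {φ : ℝ × ℝ → ℝ}
    (h0 : ∀ z ∈ strip L, z.1 < δ → φ z = 0) {z : ℝ × ℝ} (hz : z ∈ strip L) (hz' : z.1 < δ) :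
    fderiv ℝ φ z = 0 := by
  have : φ =ᶠ[𝓝 z] fun _ => (0 : ℝ) := by
    filter_upwards [(isOpen_strip L).mem_nhds hz,
      (isOpen_lt continuous_fst continuous_const).mem_nhds hz'] with w hw hw'
    exact h0 w hw hw'
  rw [this.fderiv_eq]
  simp

theorem isStripTest_cutoff {L k : ℝ} (hk : 0 < k) {η : ℝ × ℝ → ℝ} (hη : ContDiff ℝ ∞ η)
    (hη' : HasCompactSupport η) (hs : tsupport η ⊆ Iio L ×ˢ Ioi 0) :
    IsStripTest L (fun w => smoothCutoff k w.1 * 1 * η w) := by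
  refine ⟨contDiff_tensor_mul (contDiff_smoothCutoff k) (B := fun _ => 1) contDiff_const hη,
    hη'.mul_left, fun z hz => ?_⟩
  have h1 : z ∈ tsupport η := closure_mono (fun w hw => right_ne_zero_of_mul hw) hz
  have h2 : z ∈ {z : ℝ × ℝ | 1 ≤ k * z.1} := tsupport_subset_of_isClosed
    (isClosed_one_le (f := fun z => k * z.1) (by fun_prop))
    (fun w hw => lt_mul_of_smoothCutoff_ne_zero (left_ne_zero_of_mul (left_ne_zero_of_mul hw))) hz
  exact ⟨⟨pos_of_mul_pos_right (zero_lt_one.trans_le h2) hk.le, (hs h1).1⟩, (hs h1).2⟩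

/-- Mixed derivatives commute weakly for smooth functions vanishing near `x = 0`, even against
test functions that do not vanish near `x = 0`. -/
theorem integral_fderiv_mul_fderiv_comm {L δ : ℝ} (hδ : 0 < δ) {φ η : ℝ × ℝ → ℝ}
    (hφ : ContDiff ℝ ∞ φ) (h0 : ∀ z ∈ strip L, z.1 < δ → φ z = 0) (hη : ContDiff ℝ ∞ η)
    (hη' : HasCompactSupport η) (hs : tsupport η ⊆ Iio L ×ˢ Ioi 0) :
    ∫ z in strip L, fderiv ℝ φ z (0, 1) * fderiv ℝ η z (1, 0) =
      ∫ z in strip L, fderiv ℝ φ z (1, 0) * fderiv ℝ η z (0, 1) := by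
  have test := isStripTest_cutoff (k := 2 / δ) (by positivity) hη hη' hs
  set η₁ : ℝ × ℝ → ℝ := fun w => smoothCutoff (2 / δ) w.1 * 1 * η w with hη₁
  -- Replacing η by its cutoff changes nothing: φ vanishes for x < δ, and the choice k = 2/δ makes
  -- the cutoff equal to 1 for x ≥ δ.
  have repl : ∀ e e' : ℝ × ℝ, ∫ z in strip L, fderiv ℝ φ z e * fderiv ℝ η z e' =
      ∫ z in strip L, fderiv ℝ φ z e * fderiv ℝ η₁ z e' := by
    intro e e'
    refine setIntegral_congr_fun (measurableSet_strip L) fun z hz => ?_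
    rcases lt_or_ge z.1 δ with hlt | hge
    · rw [fderiv_eq_zero_of_eq_zero_near_left h0 hz hlt]
      simp
    · have hk : 2 ≤ 2 / δ * z.1 := by
        rw [div_mul_eq_mul_div, le_div_iff₀ hδ]; nlinarith
      rw [hη₁, fderiv_tensor_mul (contDiff_smoothCutoff _) (B := fun _ => 1) contDiff_const hη,
        smoothCutoff_eq_one hk, deriv_smoothCutoff_eq_zero hk]
      simp
  rw [repl, repl, integral_strip_contDiff_mul_fderiv (contDiff_fderiv_apply_const hφ _) test,
    integral_strip_contDiff_mul_fderiv (contDiff_fderiv_apply_const hφ _) test]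
  simp only [fderiv_fderiv_comm hφ (0, 1) (1, 0)]

theorem tendsto_integral_mul_of_tendsto_stripNorm {L : ℝ} {f m : ℝ × ℝ → ℝ}
    {F : ℕ → ℝ × ℝ → ℝ} (hf : MemLp f 2 (stripMeasure L))
    (hF : ∀ n, MemLp (F n) 2 (stripMeasure L)) (hm : MemLp m 2 (stripMeasure L))
    (hlim : Tendsto (fun n => stripNorm 2 L (fun z => f z - F n z)) atTop (𝓝 0)) :
    Tendsto (fun n => ∫ z in strip L, F n z * m z) atTop (𝓝 (∫ z in strip L, f z * m z)) := by
  rw [tendsto_iff_norm_sub_tendsto_zero]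
  have hb : ∀ n, ‖(∫ z in strip L, F n z * m z) - ∫ z in strip L, f z * m z‖ ≤
      (stripNorm 2 L (fun z => f z - F n z) * eLpNorm m 2 (stripMeasure L)).toReal := by
    intro n
    have hd : MemLp (fun z => f z - F n z) 2 (stripMeasure L) := hf.sub (hF n)
    have e : (∫ z in strip L, F n z * m z) - ∫ z in strip L, f z * m z =
        -∫ z in strip L, (f z - F n z) * m z := by
      have i1 : IntegrableOn (fun z => F n z * m z) (strip L) := (hF n).integrable_mul hm
      have i2 : IntegrableOn (fun z => f z * m z) (strip L) := hf.integrable_mul hm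
      rw [← integral_sub i1 i2, ← integral_neg]
      refine integral_congr_ae (ae_of_all _ fun z => ?_)
      simp only
      ring
    rw [e, norm_neg]
    have hmul := eLpNorm_smul_le_mul_eLpNorm (p := 2) (q := 2) (r := 1) hm.1 hd.1
    have hfin : stripNorm 2 L (fun z => f z - F n z) * eLpNorm m 2 (stripMeasure L) ≠ ⊤ :=
      ENNReal.mul_ne_top hd.2.ne hm.2.ne
    refine (norm_integral_le_lintegral_norm _).trans (ENNReal.toReal_mono hfin ?_)
    refine le_trans (le_of_eq ?_) hmul
    rw [eLpNorm_one_eq_lintegral_enorm]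
    refine lintegral_congr fun z => ?_
    simp only [Pi.smul_apply', smul_eq_mul]
    exact ofReal_norm _
  refine squeeze_zero (fun n => norm_nonneg _) hb ?_
  have : Tendsto (fun n => stripNorm 2 L (fun z => f z - F n z) * eLpNorm m 2 (stripMeasure L))
      atTop (𝓝 0) := by
    simpa using ENNReal.Tendsto.mul_const hlim (Or.inr hm.2.ne)
  exact (ENNReal.tendsto_toReal ENNReal.zero_ne_top).comp this

theorem memLp_strip_of_contDiff {L : ℝ} {η : ℝ × ℝ → ℝ} (hη : ContDiff ℝ ∞ η)
    (h : HasCompactSupport η) : MemLp η 2 (stripMeasure L) :=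
  (memLp_of_contDiff hη h).restrict _

/-- If `f = ∂_y` and `f₀ = ∂_x` of a function that vanishes at `x = 0`, and `g` is the weak
`y`-derivative of `f₀` inside the strip, then `g` is the weak `x`-derivative of `f`, even against
test functions that do not vanish near `x = 0`. -/
theorem integral_mul_fderiv_of_approx {L : ℝ} {f f₀ g : ℝ × ℝ → ℝ} {φ : ℕ → ℝ × ℝ → ℝ}
    (hf : MemLp f 2 (stripMeasure L)) (hf₀ : MemLp f₀ 2 (stripMeasure L))
    (hyg : MemLp (fun z => z.2 * g z) 2 (stripMeasure L))
    (hφ : ∀ n, ContDiff ℝ ∞ (φ n))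
    (hφ0 : ∀ n, ∃ δ > 0, ∀ z ∈ strip L, z.1 < δ → φ n z = 0)
    (hφx : ∀ n, MemLp (fun z => fderiv ℝ (φ n) z (1, 0)) 2 (stripMeasure L))
    (hφy : ∀ n, MemLp (fun z => fderiv ℝ (φ n) z (0, 1)) 2 (stripMeasure L))
    (hx : Tendsto (fun n => stripNorm 2 L (fun z => f₀ z - fderiv ℝ (φ n) z (1, 0))) atTop (𝓝 0))
    (hy : Tendsto (fun n => stripNorm 2 L (fun z => f z - fderiv ℝ (φ n) z (0, 1))) atTop (𝓝 0))
    (hw : ∀ η, IsStripTest L η →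
      ∫ z in strip L, f z * fderiv ℝ η z (1, 0) = -∫ z in strip L, g z * η z)
    (η : ℝ × ℝ → ℝ) (hη : ContDiff ℝ ∞ η) (hη' : HasCompactSupport η)
    (hs : tsupport η ⊆ Iio L ×ˢ Ioi 0) :
    ∫ z in strip L, f z * fderiv ℝ η z (1, 0) = -∫ z in strip L, g z * η z := by
  -- The commutation formula passes to the limit from the approximants. It trades ∂_x on the test
  -- function for ∂_y, so a cutoff in x can then be inserted without being differentiated.
  have comm : ∀ ζ : ℝ × ℝ → ℝ, ContDiff ℝ ∞ ζ → HasCompactSupport ζ →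
      tsupport ζ ⊆ Iio L ×ˢ Ioi 0 → ∫ z in strip L, f z * fderiv ℝ ζ z (1, 0) =
        ∫ z in strip L, f₀ z * fderiv ℝ ζ z (0, 1) := by
    intro ζ hζ hζ' hζs
    have t1 := tendsto_integral_mul_of_tendsto_stripNorm hf hφy
      (memLp_strip_of_contDiff (contDiff_fderiv_apply_const hζ (1, 0))
        (hasCompactSupport_fderiv_apply_const hζ' (1, 0))) hy
    have t2 := tendsto_integral_mul_of_tendsto_stripNorm hf₀ hφx
      (memLp_strip_of_contDiff (contDiff_fderiv_apply_const hζ (0, 1))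
        (hasCompactSupport_fderiv_apply_const hζ' (0, 1))) hx
    refine tendsto_nhds_unique t1 (t2.congr fun n => ?_)
    obtain ⟨δ, hδ, h0⟩ := hφ0 n
    exact (integral_fderiv_mul_fderiv_comm hδ (hφ n) h0 hζ hζ' hζs).symm
  rw [comm η hη hη' hs]
  have hη₂ := contDiff_fderiv_apply_const hη (0, 1)
  have hK : IsCompact (tsupport η) := hη'
  obtain ⟨c₂, -, hc₂⟩ := exists_abs_le_indicator hη₂.continuous
    (hasCompactSupport_fderiv_apply_const hη' (0, 1))
    (tsupport_fderiv_apply_subset_tsupport η (0, 1))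
  obtain ⟨M, hM0, hM⟩ := exists_abs_le_mul_of_eq_zero hη hη'
  have hη0 : ∀ x : ℝ, η (x, 0) = 0 := fun x =>
    image_eq_zero_of_notMem_tsupport fun h => lt_irrefl (0 : ℝ) (hs h).2
  have mc : ∀ n : ℕ, Measurable fun z : ℝ × ℝ => smoothCutoff (n + 1) z.1 := fun n =>
    (contDiff_smoothCutoff _).continuous.measurable.comp measurable_fst
  have t1 := tendsto_integral_mul_of_bounded (m := fun z => fderiv ℝ η z (0, 1))
    (M := fun n z => smoothCutoff (n + 1) z.1 * fderiv ℝ η z (0, 1)) hf₀ hK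
    (fun n => (mc n).mul hη₂.continuous.measurable)
    (fun n z _ => abs_mul_le_indicator zero_le_one (abs_smoothCutoff_le_one _ _) (hc₂ z))
    (fun z hz => by
      simpa using (tendsto_smoothCutoff hz.1.1).mul_const (fderiv ℝ η z (0, 1)))
  -- Only y g is square integrable, so g η is written as (y g)(η / y); η vanishes at y = 0 and is
  -- Lipschitz, so η / y is bounded.
  have bd : ∀ z ∈ strip L, |η z / z.2| ≤ (tsupport η).indicator (fun _ => M) z := by
    intro z hz
    have hz2 : 0 < z.2 := hz.2
    by_cases hz' : z ∈ tsupport η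
    · rw [Set.indicator_of_mem hz', abs_div, abs_of_pos hz2, div_le_iff₀ hz2]
      have := hM z (z.1, 0) (hη0 _)
      simpa [Prod.norm_def, abs_of_pos hz2, hz2.le] using this
    · rw [Set.indicator_of_notMem hz', image_eq_zero_of_notMem_tsupport hz', zero_div, abs_zero]
  have t2 := tendsto_integral_mul_of_bounded (m := fun z => η z / z.2)
    (M := fun n z => smoothCutoff (n + 1) z.1 * (η z / z.2)) hyg hK
    (fun n => (mc n).mul (hη.continuous.measurable.div measurable_snd))
    (fun n z hz => abs_mul_le_indicator zero_le_one (abs_smoothCutoff_le_one _ _) (bd z hz))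
    (fun z hz => by simpa using (tendsto_smoothCutoff hz.1.1).mul_const (η z / z.2))
  -- The cutoff test function is supported inside the strip, so the interior weak derivative
  -- applies; the commutation formula rewrites its left side.
  have eqn : ∀ n : ℕ,
      ∫ z in strip L, f₀ z * (smoothCutoff (n + 1) z.1 * fderiv ℝ η z (0, 1)) =
        -∫ z in strip L, z.2 * g z * (smoothCutoff (n + 1) z.1 * (η z / z.2)) := by
    intro n
    have test := isStripTest_cutoff (k := (n : ℝ) + 1) (by positivity) hη hη' hs
    have h := (comm _ test.1 test.2.1
      (test.2.2.trans (prod_mono_left Ioo_subset_Iio_self))).symm.trans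
      (hw _ test)
    simp only [fderiv_tensor_mul (contDiff_smoothCutoff _) (B := fun _ => 1) contDiff_const hη]
      at h
    refine Eq.trans (integral_congr_ae (ae_of_all _ fun z => ?_))
      (h.trans (congrArg Neg.neg (setIntegral_congr_fun (measurableSet_strip L) fun z hz => ?_)))
    · simp
    · have hz2 : z.2 ≠ 0 := ne_of_gt hz.2
      field_simp
  have lim := tendsto_nhds_unique (t1.congr eqn) t2.neg
  rw [lim]
  refine congrArg Neg.neg (setIntegral_congr_fun (measurableSet_strip L) fun z hz => ?_)
  have hz2 : z.2 ≠ 0 := ne_of_gt hz.2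
  field_simp

/-! ### Regularity of elements of 𝒳 -/

theorem HasWeakPartial.aestronglyMeasurable_right {L : ℝ} {e : ℝ × ℝ} {f g : ℝ × ℝ → ℝ}
    (h : HasWeakPartial L e f g) : AEStronglyMeasurable g (stripMeasure L) :=
  h.2.1.aestronglyMeasurable

theorem HasWeakPartial.integral_eq {L : ℝ} {e : ℝ × ℝ} {f g η : ℝ × ℝ → ℝ}
    (h : HasWeakPartial L e f g) (hη : IsStripTest L η) :
    ∫ z in strip L, f z * fderiv ℝ η z e = -∫ z in strip L, g z * η z :=
  h.2.2 η hη.1 hη.2.1 hη.2.2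

theorem HasWeakPartial.integrableOn_mul {L : ℝ} {e : ℝ × ℝ} {f g η : ℝ × ℝ → ℝ}
    (h : HasWeakPartial L e f g) (hη : IsStripTest L η) :
    IntegrableOn (fun z => g z * η z) (strip L) := by
  have hK : IsCompact (tsupport η) := hη.2.1
  have h1 : IntegrableOn (fun z => g z * η z) (tsupport η) :=
    (h.2.1.integrableOn_compact_subset hη.2.2 hK).mul_continuousOn hη.1.continuous.continuousOn hK
  refine h1.of_forall_sdiff_eq_zero (measurableSet_strip L) fun z hz => ?_
  rw [image_eq_zero_of_notMem_tsupport hz.2, mul_zero]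

theorem IsStripTest.fderiv {L : ℝ} {η : ℝ × ℝ → ℝ} (h : IsStripTest L η) (e : ℝ × ℝ) :
    IsStripTest L (fun z => fderiv ℝ η z e) :=
  ⟨contDiff_fderiv_apply_const h.1 e, hasCompactSupport_fderiv_apply_const h.2.1 e,
    (tsupport_fderiv_apply_subset_tsupport η e).trans h.2.2⟩

/-- First weak derivatives satisfy the compatibility condition `∂ₑ' (∂ₑ f) = ∂ₑ (∂ₑ' f)`. -/
theorem HasWeakPartial.integral_comm {L : ℝ} {e e' : ℝ × ℝ} {f g g' η : ℝ × ℝ → ℝ}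
    (h : HasWeakPartial L e f g) (h' : HasWeakPartial L e' f g') (hη : IsStripTest L η) :
    ∫ z in strip L, g z * fderiv ℝ η z e' = ∫ z in strip L, g' z * fderiv ℝ η z e := by
  have h1 := h.integral_eq (hη.fderiv e')
  have h2 := h'.integral_eq (hη.fderiv e)
  simp only [fderiv_fderiv_comm hη.1 e' e] at h1
  linarith

theorem memLp_of_tendsto_stripNorm {L : ℝ} {f : ℝ × ℝ → ℝ} {F : ℕ → ℝ × ℝ → ℝ}
    (hf : AEStronglyMeasurable f (stripMeasure L)) (hF : ∀ n, MemLp (F n) 2 (stripMeasure L))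
    (hlim : Tendsto (fun n => stripNorm 2 L (fun z => f z - F n z)) atTop (𝓝 0)) :
    MemLp f 2 (stripMeasure L) := by
  obtain ⟨n, hn⟩ := (hlim.eventually_lt_const ENNReal.zero_lt_top).exists
  have h : MemLp (fun z => f z - F n z) 2 (stripMeasure L) := ⟨hf.sub (hF n).1, hn⟩
  refine (h.add (hF n)).ae_eq (ae_of_all _ fun z => ?_)
  simp

theorem stripNorm_const_mul (L c : ℝ) (f : ℝ × ℝ → ℝ) :
    stripNorm 2 L (fun z => c * f z) = ‖c‖ₑ * stripNorm 2 L f :=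
  eLpNorm_const_smul c f 2 (stripMeasure L)

theorem tendsto_stripNorm_of_const_mul {L c : ℝ} (hc : c ≠ 0) {F : ℕ → ℝ × ℝ → ℝ}
    (h : Tendsto (fun n => stripNorm 2 L (fun z => c * F n z)) atTop (𝓝 0)) :
    Tendsto (fun n => stripNorm 2 L (F n)) atTop (𝓝 0) := by
  have h2 : Tendsto (fun n => ‖c⁻¹‖ₑ * stripNorm 2 L (fun z => c * F n z)) atTop (𝓝 0) := by
    simpa using ENNReal.Tendsto.const_mul h (Or.inr enorm_ne_top)
  refine h2.congr fun n => ?_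
  rw [← stripNorm_const_mul]
  simp only [inv_mul_cancel_left₀ hc]

theorem memLp_of_const_mul {L c : ℝ} (hc : c ≠ 0) {f : ℝ × ℝ → ℝ}
    (hf : AEStronglyMeasurable f (stripMeasure L)) (h : stripNorm 2 L (fun z => c * f z) < ⊤) :
    MemLp f 2 (stripMeasure L) := by
  have h1 : MemLp (fun z => c * f z) 2 (stripMeasure L) := ⟨hf.const_mul c, h⟩
  simpa only [inv_mul_cancel_left₀ hc] using h1.const_mul c⁻¹

/-- A continuous function that vanishes on the strip outside a bounded range of heights is square
integrable on the strip. -/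
theorem memLp_strip_of_continuous {L a b : ℝ} {f : ℝ × ℝ → ℝ} (hf : Continuous f)
    (h0 : ∀ z ∈ strip L, (z.2 < a ∨ b < z.2) → f z = 0) : MemLp f 2 (stripMeasure L) := by
  have hK : IsCompact (Icc (0 : ℝ) L ×ˢ Icc a b) := isCompact_Icc.prod isCompact_Icc
  obtain ⟨C, hC⟩ := hK.exists_bound_of_continuousOn hf.continuousOn
  have hc : MemLp ((Icc (0 : ℝ) L ×ˢ Icc a b).indicator fun _ => C) 2 (stripMeasure L) :=
    memLp_indicator_const 2 hK.measurableSet C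
      (Or.inr ((Measure.restrict_apply_le _ _).trans_lt hK.measure_lt_top).ne)
  refine hc.mono hf.aestronglyMeasurable ?_
  filter_upwards [ae_restrict_mem (measurableSet_strip L)] with z hz
  by_cases hz' : z.2 ∈ Icc a b
  · have : z ∈ Icc (0 : ℝ) L ×ˢ Icc a b := ⟨⟨hz.1.1.le, hz.1.2.le⟩, hz'⟩
    rw [Set.indicator_of_mem this]
    exact (hC z this).trans (le_abs_self C)
  · rw [h0 z hz]
    · simp
    · by_contra hcon
      push Not at hcon
      exact hz' hcon

theorem memLp_fderiv_of_vanish {L a b : ℝ} {f : ℝ × ℝ → ℝ} (hf : ContDiff ℝ ∞ f)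
    (h0 : ∀ z ∈ strip L, (z.2 < a ∨ b < z.2) → f z = 0) (e : ℝ × ℝ) :
    MemLp (fun z => fderiv ℝ f z e) 2 (stripMeasure L) := by
  refine memLp_strip_of_continuous (a := a) (b := b)
    (contDiff_fderiv_apply_const hf e).continuous fun z hz hz' => ?_
  have hopen : IsOpen {w : ℝ × ℝ | w.2 < a ∨ b < w.2} :=
    (isOpen_lt continuous_snd continuous_const).union (isOpen_lt continuous_const continuous_snd)
  have : f =ᶠ[𝓝 z] fun _ => (0 : ℝ) := by
    filter_upwards [(isOpen_strip L).mem_nhds hz, hopen.mem_nhds hz'] with w hw hw'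
    exact h0 w hw hw'
  rw [this.fderiv_eq]
  simp

theorem IsTestPair.exists_vanish {L : ℝ} {φ ψ : ℝ × ℝ → ℝ} (h : IsTestPair L φ ψ) :
    ∃ a b : ℝ, (∀ z ∈ strip L, (z.2 < a ∨ b < z.2) → φ z = 0) ∧
      ∀ z ∈ strip L, (z.2 < a ∨ b < z.2) → ψ z = 0 := by
  obtain ⟨-, -, ⟨δ, a, b, -, -, h0⟩, -⟩ := h
  exact ⟨a, b, fun z hz hz' => (h0 z hz (Or.inr hz')).1, fun z hz hz' => (h0 z hz (Or.inr hz')).2⟩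

theorem stripNorm_congr {L : ℝ} {f g : ℝ × ℝ → ℝ} (h : ∀ᵐ z ∂stripMeasure L, |f z| = |g z|) :
    stripNorm 2 L f = stripNorm 2 L g :=
  eLpNorm_congr_norm_ae h

/-- Elements of the closure of the divergence-free test pairs are divergence free. -/
theorem wdx_eq_neg_wdy {L : ℝ} {u v : ℝ × ℝ → ℝ} {φ ψ : ℕ → ℝ × ℝ → ℝ}
    (hu : MemLp u 2 (stripMeasure L)) (hux : ∃ g, HasWeakPartial L (1, 0) u g)
    (hvy : ∃ g, HasWeakPartial L (0, 1) v g) (hv₂ : MemLp (wdy L v) 2 (stripMeasure L))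
    (htest : ∀ n, IsTestPair L (φ n) (ψ n))
    (hφ : Tendsto (fun n => stripNorm 2 L (fun z => u z - φ n z)) atTop (𝓝 0))
    (hψ : Tendsto (fun n => stripNorm 2 L (fun z => wdy L v z - fderiv ℝ (ψ n) z (0, 1)))
      atTop (𝓝 0)) :
    ∀ᵐ z ∂stripMeasure L, wdx L u z = -wdy L v z := by
  have hux' : HasWeakPartial L (1, 0) u (wdx L u) := hasWeakPartial_weakPartial hux
  have hvy' : HasWeakPartial L (0, 1) v (wdy L v) := hasWeakPartial_weakPartial hvy
  have hφL : ∀ n, MemLp (φ n) 2 (stripMeasure L) := fun n => by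
    obtain ⟨a, b, h, -⟩ := (htest n).exists_vanish
    exact memLp_strip_of_continuous (htest n).1.continuous h
  have hψL : ∀ n, MemLp (fun z => fderiv ℝ (ψ n) z (0, 1)) 2 (stripMeasure L) := fun n => by
    obtain ⟨a, b, -, h⟩ := (htest n).exists_vanish
    exact memLp_fderiv_of_vanish (htest n).2.1 h _
  have key : ∀ η, IsStripTest L η →
      ∫ z in strip L, u z * fderiv ℝ η z (1, 0) = ∫ z in strip L, wdy L v z * η z := by
    intro η hη
    have t1 := tendsto_integral_mul_of_tendsto_stripNorm hu hφL
      (memLp_strip_of_contDiff (hη.fderiv (1, 0)).1 (hη.fderiv (1, 0)).2.1) hφ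
    have t2 := tendsto_integral_mul_of_tendsto_stripNorm hv₂ hψL
      (memLp_strip_of_contDiff hη.1 hη.2.1) hψ
    refine tendsto_nhds_unique t1 (t2.congr fun n => ?_)
    rw [integral_strip_contDiff_mul_fderiv (htest n).1 hη, ← integral_neg]
    refine setIntegral_congr_fun (measurableSet_strip L) fun z hz => ?_
    have := (htest n).2.2.2 z hz
    linear_combination η z * this
  have hae := (isOpen_strip L).ae_eq_zero_of_integral_contDiff_smul_eq_zero (μ := volume)
    (hux'.2.1.add hvy'.2.1) ?_
  · filter_upwards [ae_restrict_of_ae hae, ae_restrict_mem (measurableSet_strip L)] with z hz hz'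
    have := hz hz'
    simp only [Pi.add_apply] at this
    linarith
  · intro η hη hη' hs
    have hT : IsStripTest L η := ⟨hη, hη', hs⟩
    have h1 := (key η hT).symm.trans (hux'.integral_eq hT)
    have i1 := hux'.integrableOn_mul hT
    have i2 := hvy'.integrableOn_mul hT
    have h2 : ∫ z in strip L, (wdx L u z + wdy L v z) * η z = 0 := by
      simp only [add_mul]
      rw [integral_add i1 i2]
      linarith
    rw [setIntegral_strip_mul_eq_integral hs] at h2
    rw [← h2]
    refine integral_congr_ae (ae_of_all _ fun z => ?_)
    simp only [smul_eq_mul, Pi.add_apply]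
    ring

/-- The regularity that membership in `𝒳` provides for `a = y u_y` and `b = y u_x`. -/
theorem spaceX_regularity {ε γ L : ℝ} (hε : 0 < ε) {u v : ℝ × ℝ → ℝ}
    (h : (u, v) ∈ spaceX ε γ L) :
    (MemLp (wdx L u) 2 (stripMeasure L) ∧ MemLp (wdy L u) 2 (stripMeasure L)) ∧
    (MemLp (fun z => z.2 * wdx L u z) 2 (stripMeasure L) ∧
      MemLp (fun z => z.2 * wdy L u z) 2 (stripMeasure L)) ∧
    (MemLp (fun z => z.2 * wdx L (wdx L u) z) 2 (stripMeasure L) ∧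
      MemLp (fun z => z.2 * wdy L (wdx L u) z) 2 (stripMeasure L) ∧
      MemLp (fun z => z.2 * wdy L (wdy L u) z) 2 (stripMeasure L)) ∧
    (HasStripGreenX L (fun z => z.2 * wdy L u z) (fun z => z.2 * wdy L (wdx L u) z) ∧
      HasStripGreenY L (fun z => z.2 * wdy L u z)
        (fun z => wdy L u z + z.2 * wdy L (wdy L u) z)) ∧
    HasStripGreenX L (fun z => z.2 * wdx L u z) (fun z => z.2 * wdx L (wdx L u) z) ∧
      HasStripGreenY L (fun z => z.2 * wdx L u z)
        (fun z => wdx L u z + z.2 * wdy L (wdx L u) z) := by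
  obtain ⟨⟨hu, hv, hdu, hdv, φ, ψ, htest, lim0, lim1⟩, hdux, hduy, -, -, hfin⟩ := h
  simp only at hu hv hdu hdv lim0 lim1 hdux hduy hfin
  have hsε : √ε ≠ 0 := (Real.sqrt_pos.2 hε).ne'
  have ux : HasWeakPartial L (1, 0) u (wdx L u) := hasWeakPartial_weakPartial hdu.1
  have uy : HasWeakPartial L (0, 1) u (wdy L u) := hasWeakPartial_weakPartial hdu.2
  have vx : HasWeakPartial L (1, 0) v (wdx L v) := hasWeakPartial_weakPartial hdv.1
  have vy : HasWeakPartial L (0, 1) v (wdy L v) := hasWeakPartial_weakPartial hdv.2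
  have uxx : HasWeakPartial L (1, 0) (wdx L u) (wdx L (wdx L u)) :=
    hasWeakPartial_weakPartial hdux.1
  have uxy : HasWeakPartial L (0, 1) (wdx L u) (wdy L (wdx L u)) :=
    hasWeakPartial_weakPartial hdux.2
  have uyy : HasWeakPartial L (0, 1) (wdy L u) (wdy L (wdy L u)) :=
    hasWeakPartial_weakPartial hduy.2
  have hφd : ∀ n e, MemLp (fun z => fderiv ℝ (φ n) z e) 2 (stripMeasure L) := fun n e => by
    obtain ⟨a, b, h, -⟩ := (htest n).exists_vanish
    exact memLp_fderiv_of_vanish (htest n).1 h e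
  have hψd : ∀ n e, MemLp (fun z => fderiv ℝ (ψ n) z e) 2 (stripMeasure L) := fun n e => by
    obtain ⟨a, b, -, h⟩ := (htest n).exists_vanish
    exact memLp_fderiv_of_vanish (htest n).2.1 h e
  have squeeze : ∀ {x y : ℕ → ℝ≥0∞}, Tendsto y atTop (𝓝 0) → (∀ n, x n ≤ y n) →
      Tendsto x atTop (𝓝 0) := fun hy hle =>
    tendsto_of_tendsto_of_tendsto_of_le_of_le tendsto_const_nhds hy (fun _ => zero_le) hle
  have lu := squeeze lim0 fun n => le_self_add
  have luy := squeeze lim1 fun n => le_self_add.trans le_self_add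
  have lvy := tendsto_stripNorm_of_const_mul hsε
    (squeeze lim1 fun n => le_add_self.trans le_self_add)
  have lvx := tendsto_stripNorm_of_const_mul hε.ne' (squeeze lim1 fun n => le_add_self)
  have mvy := memLp_of_tendsto_stripNorm vy.aestronglyMeasurable_right (fun n => hψd n (0, 1)) lvy
  have mvx := memLp_of_tendsto_stripNorm vx.aestronglyMeasurable_right (fun n => hψd n (1, 0)) lvx
  have muy := memLp_of_tendsto_stripNorm uy.aestronglyMeasurable_right (fun n => hφd n (0, 1)) luy
  -- The 𝒳₀ norm contains no u_x; its square integrability and its approximation come from v_y.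
  have hdiv := wdx_eq_neg_wdy hu hdu.1 hdv.2 mvy htest lu lvy
  have mux : MemLp (wdx L u) 2 (stripMeasure L) :=
    mvy.neg.ae_eq (hdiv.mono fun z hz => hz.symm)
  have hdivn : ∀ n, ∀ᵐ z ∂stripMeasure L,
      fderiv ℝ (φ n) z (1, 0) = -fderiv ℝ (ψ n) z (0, 1) := fun n => by
    filter_upwards [ae_restrict_mem (measurableSet_strip L)] with z hz
    linarith [(htest n).2.2.2 z hz]
  have lux : Tendsto (fun n => stripNorm 2 L (fun z => wdx L u z - fderiv ℝ (φ n) z (1, 0)))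
      atTop (𝓝 0) := by
    refine lvy.congr fun n => stripNorm_congr ?_
    filter_upwards [hdiv, hdivn n] with z h1 h2
    rw [h1, h2, ← abs_neg]
    congr 1
    ring
  have lux' : Tendsto (fun n => stripNorm 2 L (fun z => wdx L u z - -fderiv ℝ (ψ n) z (0, 1)))
      atTop (𝓝 0) := by
    refine lux.congr fun n => stripNorm_congr ?_
    filter_upwards [hdivn n] with z h2
    rw [h2]
  have lvx' : Tendsto (fun n => stripNorm 2 L (fun z => -wdx L v z - -fderiv ℝ (ψ n) z (1, 0)))
      atTop (𝓝 0) := by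
    refine lvx.congr fun n => stripNorm_congr (ae_of_all _ fun z => ?_)
    rw [← abs_neg]
    congr 1
    ring
  have my : AEStronglyMeasurable (fun z : ℝ × ℝ => z.2) (stripMeasure L) :=
    continuous_snd.aestronglyMeasurable
  have mulmem : ∀ {c : ℝ} {f : ℝ × ℝ → ℝ}, c ≠ 0 → AEStronglyMeasurable f (stripMeasure L) →
      stripNorm 2 L (fun z => c * f z * z.2) < ⊤ →
      MemLp (fun z => z.2 * f z) 2 (stripMeasure L) := by
    intro c f hc hf hlt
    refine memLp_of_const_mul hc (my.mul hf) ?_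
    convert hlt using 3 with z
    ring
  unfold normX at hfin
  simp only [ENNReal.add_lt_top] at hfin
  obtain ⟨⟨⟨⟨⟨⟨⟨⟨f1, f2⟩, -⟩, -⟩, f5⟩, f6⟩, f7⟩, -⟩, -⟩ := hfin
  have yuy := mulmem one_ne_zero uy.aestronglyMeasurable_right (by simpa only [one_mul] using f1)
  have yux := mulmem hsε ux.aestronglyMeasurable_right f2
  have yuyy := mulmem one_ne_zero uyy.aestronglyMeasurable_right (by simpa only [one_mul] using f5)
  have yuxy := mulmem hsε uxy.aestronglyMeasurable_right f6
  have yuxx := mulmem hε.ne' uxx.aestronglyMeasurable_right f7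
  refine ⟨⟨mux, muy⟩, ⟨yux, yuy⟩, ⟨yuxx, yuxy, yuyy⟩, ⟨?_, ?_⟩, ?_, ?_⟩
  -- The potential is u itself: f = u_y, f₀ = u_x, approximated by derivatives of φ n. The interior
  -- x-derivative of u_y is u_xy by commutation of weak derivatives.
  · refine hasStripGreenX_mul yuy yuxy (integral_mul_fderiv_of_approx muy mux yuxy
      (fun n => (htest n).1) (fun n => ?_) (fun n => hφd n _) (fun n => hφd n _) lux luy
      fun η hη => ?_)
    · obtain ⟨δ, a, b, hδ, -, h0⟩ := (htest n).2.2.1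
      exact ⟨δ, hδ, fun z hz hz' => (h0 z hz (Or.inl hz')).1⟩
    · rw [uy.integral_comm ux hη, uxy.integral_eq hη]
  · exact hasStripGreenY_mul muy yuy yuyy fun η hη => uyy.integral_eq hη
  -- The potential is now -v: f = u_x = -v_y and f₀ = -v_x, approximated by derivatives of -ψ n.
  -- This encodes the vanishing of u_x at x = 0.
  · refine hasStripGreenX_mul yux yuxx (integral_mul_fderiv_of_approx (φ := fun n z => -ψ n z)
      mux (f₀ := fun z => -wdx L v z) mvx.neg yuxx
      (fun n => (htest n).2.1.neg) (fun n => ?_) (fun n => ?_) (fun n => ?_) ?_ ?_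
      fun η hη => uxx.integral_eq hη)
    · obtain ⟨δ, a, b, hδ, -, h0⟩ := (htest n).2.2.1
      exact ⟨δ, hδ, fun z hz hz' => by rw [(h0 z hz (Or.inl hz')).2, neg_zero]⟩
    · simpa [fderiv_fun_neg] using! (hψd n (1, 0)).neg
    · simpa [fderiv_fun_neg] using! (hψd n (0, 1)).neg
    · simpa only [fderiv_fun_neg, neg_apply] using lvx'
    · simpa only [fderiv_fun_neg, neg_apply] using lux'
  · exact hasStripGreenY_mul mux yux yuxy fun η hη => uxy.integral_eq hη

/-! ### The weighted inequality -/

theorem mainTheorem9 (L₀ : ℝ) (hL₀ : 0 < L₀) (hL₀' : L₀ < 1) :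
    ∃ c C : ℝ, 0 < c ∧ 0 < C ∧
      ∀ L ε γ : ℝ, 0 < L → L ≤ L₀ → 0 < ε → ε ≤ 1 →
        ∀ u v : ℝ × ℝ → ℝ, (u, v) ∈ spaceX ε γ L →
          IntegrableOn (kornEnergy ε L u) (strip L) ∧
          IntegrableOn (hessianEnergy ε L u) (strip L) ∧
          c * (∫ z in strip L, hessianEnergy ε L u z)
              - C * (ε * (∫ z in strip L,
                    ((wdy L u z * z.2) ^ 2 + (√ε * wdx L u z * z.2) ^ 2))
                  + ∫ z in strip L, (wdy L u z ^ 2 + wdx L u z ^ 2))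
            ≤ ∫ z in strip L, kornEnergy ε L u z := by
  -- The factor 1 - L₀ is the lower bound of the weight, and 506 = 4 · 126 + 2 comes from absorbing
  -- the lower order terms in `main`.
  refine ⟨(1 - L₀) / 506, 1, by linarith [sub_pos.2 hL₀'], one_pos, ?_⟩
  intro L ε γ hL hLL₀ hε hε1 u v huv
  obtain ⟨⟨mt, ms⟩, ⟨yux, yuy⟩, ⟨mr, mq, mp⟩, ⟨gax, gay⟩, gbx, gbY⟩ := spaceX_regularity hε huv
  -- Applied to a = y u_y and b = y u_x, with a_y = u_y + y u_yy and b_y = u_x + y u_xy.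
  have korn := strip_korn hε.le yuy mq (ms.add mp) yux mr (mt.add mq) gax gay gbx gbY
  set p : ℝ × ℝ → ℝ := fun z => z.2 * wdy L (wdy L u) z with hp
  set q : ℝ × ℝ → ℝ := fun z => z.2 * wdy L (wdx L u) z with hq
  set r : ℝ × ℝ → ℝ := fun z => z.2 * wdx L (wdx L u) z with hr
  set s : ℝ × ℝ → ℝ := wdy L u with hs
  set t : ℝ × ℝ → ℝ := wdx L u with ht
  have mD : MemLp (fun z => p z - ε * r z) 2 (stripMeasure L) := mp.sub (mr.const_mul ε)
  set E₀ : ℝ × ℝ → ℝ := fun z => (p z - ε * r z) ^ 2 + 4 * ε * q z ^ 2 with hE₀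
  set H₀ : ℝ × ℝ → ℝ := fun z => p z ^ 2 + ε * q z ^ 2 + ε ^ 2 * r z ^ 2 with hH₀
  have iE₀ : IntegrableOn E₀ (strip L) := mD.integrable_sq.add (mq.integrable_sq.const_mul _)
  have iH₀ : IntegrableOn H₀ (strip L) :=
    (mp.integrable_sq.add (mq.integrable_sq.const_mul _)).add (mr.integrable_sq.const_mul _)
  have iR : IntegrableOn (fun z => s z ^ 2 + t z ^ 2) (strip L) :=
    ms.integrable_sq.add mt.integrable_sq
  have eE : kornEnergy ε L u = fun z => E₀ z * kornWeight z.1 := by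
    funext z
    simp only [kornEnergy, hE₀, hp, hq, hr]
    ring
  have eH : hessianEnergy ε L u = fun z => H₀ z * kornWeight z.1 := by
    funext z
    simp only [hessianEnergy, hH₀, hp, hq, hr]
    ring
  have nE : ∀ z, 0 ≤ E₀ z := fun z => by simp only [hE₀]; positivity
  have nH : ∀ z, 0 ≤ H₀ z := fun z => by simp only [hH₀]; positivity
  have mw : Continuous fun z : ℝ × ℝ => kornWeight z.1 := by unfold kornWeight; fun_prop
  have w0 : ∀ z ∈ strip L, 1 - L₀ ≤ kornWeight z.1 ∧ kornWeight z.1 ≤ 1 := fun z hz => by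
    have h1 : 0 < z.1 := hz.1.1
    have h2 : z.1 < L := hz.1.2
    simp only [kornWeight]
    constructor <;> linarith
  have iw : ∀ {F : ℝ × ℝ → ℝ}, IntegrableOn F (strip L) →
      IntegrableOn (fun z => F z * kornWeight z.1) (strip L) := by
    intro F hF
    refine Integrable.mono hF (hF.1.mul mw.aestronglyMeasurable) ?_
    filter_upwards [ae_restrict_mem (measurableSet_strip L)] with z hz
    obtain ⟨h1, h2⟩ := w0 z hz
    rw [norm_mul, Real.norm_of_nonneg (by linarith : 0 ≤ kornWeight z.1)]
    exact mul_le_of_le_one_right (norm_nonneg _) h2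
  have kE : (1 - L₀) * ∫ z in strip L, E₀ z ≤ ∫ z in strip L, kornEnergy ε L u z := by
    rw [eE, ← integral_const_mul]
    refine setIntegral_mono_on (iE₀.const_mul _) (iw iE₀) (measurableSet_strip L) fun z hz => ?_
    nlinarith [nE z, (w0 z hz).1]
  have kH : ∫ z in strip L, hessianEnergy ε L u z ≤ ∫ z in strip L, H₀ z := by
    rw [eH]
    refine setIntegral_mono_on (iw iH₀) iH₀ (measurableSet_strip L) fun z hz => ?_
    nlinarith [nH z, (w0 z hz).2]
  have main : ∫ z in strip L, H₀ z ≤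
      506 * ((∫ z in strip L, E₀ z) + ∫ z in strip L, (s z ^ 2 + t z ^ 2)) := by
    have i1 : IntegrableOn (fun z => (s z + p z) ^ 2) (strip L) := (ms.add mp).integrable_sq
    have i2 : IntegrableOn (fun z => r z ^ 2) (strip L) := mr.integrable_sq
    have i3 : IntegrableOn (fun z => (s z + p z - ε * r z) ^ 2) (strip L) :=
      ((ms.add mp).sub (mr.const_mul ε)).integrable_sq
    have i4 : IntegrableOn (fun z => q z ^ 2) (strip L) := mq.integrable_sq
    have i5 : IntegrableOn (fun z => (t z + q z) ^ 2) (strip L) := (mt.add mq).integrable_sq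
    have i45 : IntegrableOn (fun z => q z ^ 2 + (t z + q z) ^ 2) (strip L) := i4.add i5
    have j1 : IntegrableOn (fun z => (s z + p z) ^ 2 + ε ^ 2 * r z ^ 2) (strip L) :=
      i1.add (i2.const_mul _)
    have j2 : IntegrableOn (fun z => 126 * ((s z + p z - ε * r z) ^ 2 +
        ε * (q z ^ 2 + (t z + q z) ^ 2))) (strip L) := (i3.add (i45.const_mul _)).const_mul _
    have j3 : IntegrableOn (fun z => 506 * (E₀ z + (s z ^ 2 + t z ^ 2))) (strip L) :=
      (iE₀.add iR).const_mul _
    have korn' : ∫ z in strip L, ((s z + p z) ^ 2 + ε ^ 2 * r z ^ 2) ≤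
        ∫ z in strip L, 126 * ((s z + p z - ε * r z) ^ 2 +
          ε * (q z ^ 2 + (t z + q z) ^ 2)) := by
      rw [integral_add i1 (i2.const_mul _), integral_const_mul, integral_const_mul,
        integral_add i3 (i45.const_mul _), integral_const_mul, integral_add i4 i5]
      exact korn
    -- Pointwise, p² ≤ 2(s + p)² + 2s², (s + p - ε r)² ≤ 2s² + 2(p - ε r)² and (t + q)² ≤ 2t² + 2q².
    -- Twice the Korn inequality is added so that the terms (s + p)² and ε² r² cancel; ε ≤ 1 absorbs
    -- ε t².
    have pt : ∫ z in strip L, (H₀ z + 2 * (126 * ((s z + p z - ε * r z) ^ 2 +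
        ε * (q z ^ 2 + (t z + q z) ^ 2)))) ≤ ∫ z in strip L,
        (506 * (E₀ z + (s z ^ 2 + t z ^ 2)) + 2 * ((s z + p z) ^ 2 + ε ^ 2 * r z ^ 2)) := by
      refine integral_mono (iH₀.add (j2.const_mul _)) (j3.add (j1.const_mul _)) fun z => ?_
      simp only [hH₀, hE₀]
      have e1 : 0 ≤ ε * (t z - q z) ^ 2 := by positivity
      have e2 : 0 ≤ (1 - ε) * t z ^ 2 := mul_nonneg (by linarith) (sq_nonneg _)
      have e3 : 0 ≤ ε * q z ^ 2 := by positivity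
      nlinarith [sq_nonneg (s z - (p z - ε * r z)), sq_nonneg (2 * s z + p z), sq_nonneg (t z),
        sq_nonneg (ε * r z), sq_nonneg (p z - ε * r z), sq_nonneg (s z)]
    rw [integral_add iH₀ (j2.const_mul _), integral_add j3 (j1.const_mul _),
      integral_const_mul 2, integral_const_mul 2, integral_const_mul 506,
      integral_add iE₀ iR] at pt
    linarith
  refine ⟨eE ▸ iw iE₀, eH ▸ iw iH₀, ?_⟩
  have n1 : 0 ≤ ∫ z in strip L, ((s z * z.2) ^ 2 + (√ε * t z * z.2) ^ 2) :=
    integral_nonneg fun z => by positivity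
  have n2 : 0 ≤ ∫ z in strip L, (s z ^ 2 + t z ^ 2) := integral_nonneg fun z => by positivity
  have n3 := mul_nonneg hε.le n1
  have hm : 0 < 1 - L₀ := sub_pos.2 hL₀'
  -- This leaves (1 - L₀) times the integrals of E₀ and s² + t²: the first is bounded by the
  -- weighted energy, the second by the remainder with C = 1, and the ε term of the remainder is
  -- nonnegative.
  have step := mul_le_mul_of_nonneg_left (kH.trans main) (by positivity : 0 ≤ (1 - L₀) / 506)
  have n4 := mul_nonneg hL₀.le n2
  linarith
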